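/- Let $E=(E^0,E^1,r,s)$ be a countable directed graph which is row-finite ($r^{-1}(x)$ is finite for every $x\in E^0$) and has no sources ($r^{-1}(x)\neq\emptyset$ for every $x\in E^0$). Let $G$ be a discrete group acting on $E$ by graph automorphisms, and let $\varphi:G\times E^1\to G$ be a one-cocycle, i.e. $\varphi(gh,a)=\varphi(g,ha)\varphi(h,a)$, such that $\varphi(g,a)\cdot s(a)=g\cdot s(a)$ for all $g,h\in G$, $a\in E^1$. Finite paths are words $a_1\cdots a_n$ with $s(a_i)=r(a_{i+1})$, with range $r(a_1)$ and source $s(a_n)$; the paths of length $0$ are the vertices. $E^*$ denotes the set of finite paths. $E^\infty$ denotes the space of infinite paths $a_1a_2\cdots$ with $s(a_i)=r(a_{i+1})$, with the topology whose basis consists of the cylinders $Z(\gamma)=\{\gamma\eta:\eta\in E^\infty,\ r(\eta)=s(\gamma)\}$, $\gamma\in E^*$. The action and the cocycle extend to finite paths by $g(a\alpha)=(ga)(\varphi(g,a)\alpha)$, $\varphi(g,a\alpha)=\varphi(\varphi(g,a),\alpha)$, $\varphi(g,x)=g$ for $x\in E^0$, and the action extends to $E^\infty$ in the same way. Let $\mathcal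 S_{G,E}=\{(\alpha,g,\beta):\alpha,\beta\in E^*,\ g\in G,\ s(\alpha)=g\,s(\beta)\}\cup\{0\}$ be the inverse semigroup with $(\alpha,g,\beta)^*=(\beta,g^{-1},\alpha)$ and $$(\alpha,g,\beta)(\gamma,h,\delta)=\begin{cases}(\alpha\, g\varepsilon,\ \varphi(g,\varepsilon)h,\ \delta)&\text{if }\gamma=\beta\varepsilon,\\ (\alpha,\ g\varphi(h^{-1},\varepsilon)^{-1},\ \delta\, h^{-1}\varepsilon)&\text{if }\beta=\gamma\varepsilon,\\ 0&\text{otherwise.}\end{cases}$$ It acts on $E^\infty$ by partial homeomorphisms (the standard action): $(\alpha,g,\beta)$ maps $Z(\beta)$ onto $Z(\alpha)$ by $\beta\eta\mapsto\alpha(g\eta)$, and $0$ acts as the empty map. This action is topologically free if for every $t\in\mathcal S_{G,E}$, each interior point $\omega$ of the set of fixed points of $t$ is trivially fixed, i.e. lies in the domain of an idempotent $e\le t$. Let $\mathcal G_{\rm tight}^{(G,E)}$ be the groupoid of germs of the action of $\mathcal S_{G,E}$ on the space of tight filters of its idempotent semilattice; it is essentially principal if the interior of its isotropy bundle $\{\gamma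 : r(\gamma)=s(\gamma)\}$ equals its unit space. A $G$-circuit is a pair $(g,\gamma)$ with $g\in G$ and $\gamma\in E^*$ of nonzero length such that $s(\gamma)=g\,r(\gamma)$; it has an entry if some edge $b$ has the same range as some edge $a$ of $\gamma$ and $b\ne a$. A finite path $\gamma$ is strongly fixed by $g$ if $g\gamma=\gamma$ and $\varphi(g,\gamma)=1$; $g$ is slack at $x\in E^0$ if there is $n\in\mathbb N$ such that every $\gamma\in E^*$ with $r(\gamma)=x$ and $|\gamma|\ge n$ is strongly fixed by $g$. **Theorem.** The standard action of $\mathcal S_{G,E}$ on $E^\infty$ is topologically free if and only if $\mathcal G_{\rm tight}^{(G,E)}$ is essentially principal, and this happens if and only if the following two conditions hold: 1. Every $G$-circuit has an entry. 2. For every $x\in E^0$ and every $g\in G$, if $g$ fixes $Z(x)$ pointwise, then $g$ is slack at $x$. -/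

import Mathlib

/-- The data of a self-similar graph `(G, E, φ)`: a directed graph `E` with vertex set `V`, edge
set `A`, range map `rng` and source map `src`; an action of the group `G` on `E` by graph
automorphisms; and a one-cocycle `φ : G × A → G` with `φ(g, a) • src a = g • src a`. -/
structure SelfSimilarGraph (G V A : Type*) [Group G] [MulAction G V] [MulAction G A] where
  rng : A → V
  src : A → V
  rng_smul : ∀ (g : G) (a : A), rng (g • a) = g • rng a
  src_smul : ∀ (g : G) (a : A), src (g • a) = g • src a
  φ : G → A → G
  φ_mul : ∀ (g h : G) (a : A), φ (g * h) a = φ g (h • a) * φ h a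
  φ_src : ∀ (g : G) (a : A), φ g a • src a = g • src a

namespace SelfSimilarGraph

section

variable {G V A : Type*} [Group G] [MulAction G V] [MulAction G A] (T : SelfSimilarGraph G V A)

/-- Every vertex receives only finitely many edges. -/
def RowFinite : Prop := ∀ x : V, {a : A | T.rng a = x}.Finite

/-- Every vertex receives at least one edge. -/
def NoSources : Prop := ∀ x : V, ∃ a : A, T.rng a = x

/-! ### Finite paths -/

/-- `IsPathFrom x [a₁, …, aₙ]` says that `x = rng a₁` and `src aᵢ = rng aᵢ₊₁`. -/
def IsPathFrom : V → List A → Prop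
  | _, [] => True
  | x, a :: l => T.rng a = x ∧ IsPathFrom (T.src a) l

/-- The source of a finite path with range `x` and the given edges. -/
def srcFrom : V → List A → V
  | x, [] => x
  | _, a :: l => srcFrom (T.src a) l

/-- `g (a l) = (g a) (φ(g, a) l)`. -/
def actList : G → List A → List A
  | _, [] => []
  | g, a :: l => (g • a) :: actList (T.φ g a) l

/-- `φ(g, a l) = φ(φ(g, a), l)`, and `φ(g, x) = g` for paths `x` of length zero. -/
def cocList : G → List A → G
  | g, [] => g
  | g, a :: l => cocList (T.φ g a) l

/-- Finite paths `α = a₁ a₂ ⋯ aₙ` with `src aᵢ = rng aᵢ₊₁`; those of length zero are the vertices. -/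
@[ext]
structure FinPath where
  /-- the range `r(α)` -/
  range : V
  edges : List A
  isPath : T.IsPathFrom range edges

lemma isPathFrom_append {x : V} {l m : List A} :
    T.IsPathFrom x (l ++ m) ↔ T.IsPathFrom x l ∧ T.IsPathFrom (T.srcFrom x l) m := by
  induction l generalizing x with
  | nil => simp [IsPathFrom, srcFrom]
  | cons a l ih => simp [IsPathFrom, srcFrom, ih, and_assoc]

lemma srcFrom_append (x : V) (l m : List A) :
    T.srcFrom x (l ++ m) = T.srcFrom (T.srcFrom x l) m := by
  induction l generalizing x with
  | nil => simp [srcFrom]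
  | cons a l ih => simp [srcFrom, ih]

lemma isPathFrom_actList {x : V} {l : List A} (g : G) (h : T.IsPathFrom x l) :
    T.IsPathFrom (g • x) (T.actList g l) := by
  induction l generalizing x g with
  | nil => trivial
  | cons a l ih =>
    refine ⟨by rw [T.rng_smul, h.1], ?_⟩
    rw [T.src_smul, ← T.φ_src]
    exact ih _ h.2

lemma srcFrom_actList (x : V) (l : List A) (g : G) :
    T.srcFrom (g • x) (T.actList g l) = T.cocList g l • T.srcFrom x l := by
  induction l generalizing x g with
  | nil => rfl
  | cons a l ih =>
    simp only [actList, srcFrom, cocList]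
    rw [T.src_smul, ← T.φ_src, ih]

variable {T}

/-- The source `s(α)` of a finite path. -/
def FinPath.source (α : T.FinPath) : V := T.srcFrom α.range α.edges

/-- The length `|α|` of a finite path. -/
def FinPath.length (α : T.FinPath) : ℕ := α.edges.length

/-- The path `g α`. -/
def FinPath.act (g : G) (α : T.FinPath) : T.FinPath :=
  ⟨g • α.range, T.actList g α.edges, T.isPathFrom_actList g α.isPath⟩

/-- `φ(g, α)`. -/
def FinPath.coc (g : G) (α : T.FinPath) : G := T.cocList g α.edges

/-- The concatenation `α ε`. -/
def FinPath.append (α ε : T.FinPath) (h : ε.range = α.source) : T.FinPath :=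
  ⟨α.range, α.edges ++ ε.edges, T.isPathFrom_append.2 ⟨α.isPath, by
    have := ε.isPath
    rw [h] at this
    exact this⟩⟩

/-- `γ` is a prefix of `β`, that is, `β = γ ε` for some (unique) finite path `ε`. -/
def FinPath.IsPrefix (γ β : T.FinPath) : Prop := γ.range = β.range ∧ γ.edges <+: β.edges

/-- The path `ε` with `β = γ ε`, for a prefix `γ` of `β`. -/
def FinPath.rest (γ β : T.FinPath) (h : γ.IsPrefix β) : T.FinPath :=
  ⟨γ.source, β.edges.drop γ.edges.length, by
    obtain ⟨hr, m, hm⟩ := h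
    have hβ := β.isPath
    rw [← hm, ← hr] at hβ
    rw [← hm, List.drop_left]
    exact (T.isPathFrom_append.1 hβ).2⟩

lemma FinPath.range_act_rest (γ β α : T.FinPath) (h : γ.IsPrefix β) (g : G)
    (hs : g • γ.source = α.source) : ((γ.rest β h).act g).range = α.source := hs

lemma FinPath.source_append (α ε : T.FinPath) (h : ε.range = α.source) :
    (α.append ε h).source = ε.source := by
  simp only [FinPath.source, FinPath.append, srcFrom_append]
  rw [h]; rfl

lemma FinPath.source_act (g : G) (α : T.FinPath) :
    (α.act g).source = α.coc g • α.source :=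
  T.srcFrom_actList _ _ _

lemma FinPath.source_rest (γ β : T.FinPath) (h : γ.IsPrefix β) :
    (γ.rest β h).source = β.source := by
  obtain ⟨hr, m, hm⟩ := h
  simp only [FinPath.source, FinPath.rest]
  rw [← hm, List.drop_left, srcFrom_append, hr]

/-! ### Infinite paths -/

variable (T) in
/-- The space `E^∞` of infinite paths `a₁ a₂ a₃ ⋯` with `src aᵢ = rng aᵢ₊₁`. -/
@[ext]
structure InfPath where
  edge : ℕ → A
  isPath : ∀ n, T.src (edge n) = T.rng (edge (n + 1))

/-- The range of an infinite path. -/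
def InfPath.range (η : T.InfPath) : V := T.rng (η.edge 0)

variable (T) in
/-- `cocSeq g a n = φ(g, a₀ a₁ ⋯ aₙ₋₁)`. -/
def cocSeq (g : G) (a : ℕ → A) : ℕ → G
  | 0 => g
  | n + 1 => T.φ (cocSeq g a n) (a n)

/-- The action of `G` on infinite paths: the `n`-th edge of `g η` is
`φ(g, η₀ ⋯ ηₙ₋₁) • ηₙ`. -/
def InfPath.act (g : G) (η : T.InfPath) : T.InfPath :=
  ⟨fun n => T.cocSeq g η.edge n • η.edge n, fun n => by
    rw [T.src_smul, T.rng_smul, ← η.isPath, ← T.φ_src]; rfl⟩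

/-- The sequence `l₁, …, lₙ, a₀, a₁, …`. -/
def appendSeq : List A → (ℕ → A) → ℕ → A
  | [], a, n => a n
  | b :: _, _, 0 => b
  | _ :: l, a, n + 1 => appendSeq l a n

variable (T) in
lemma appendSeq_isPath (η : T.InfPath) (l : List A) (x : V) (hl : T.IsPathFrom x l)
    (h : η.range = T.srcFrom x l) :
    T.rng (appendSeq l η.edge 0) = x ∧
      ∀ n, T.src (appendSeq l η.edge n) = T.rng (appendSeq l η.edge (n + 1)) := by
  induction l generalizing x with
  | nil => exact ⟨h, η.isPath⟩
  | cons b l ih =>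
    obtain ⟨h0, h1⟩ := ih (T.src b) hl.2 h
    refine ⟨hl.1, fun n => ?_⟩
    cases n with
    | zero => exact h0.symm
    | succ n => exact h1 n

/-- The infinite path `α η`. -/
def FinPath.appendInf (α : T.FinPath) (η : T.InfPath) (h : η.range = α.source) : T.InfPath :=
  ⟨appendSeq α.edges η.edge, (T.appendSeq_isPath η α.edges α.range α.isPath h).2⟩

/-- The cylinder `Z(γ) = {γ η : η ∈ E^∞, r(η) = s(γ)}`. -/
def FinPath.cylinder (γ : T.FinPath) : Set T.InfPath :=
  {ω | ∃ (η : T.InfPath) (h : η.range = γ.source), ω = γ.appendInf η h}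

/-- The topology of `E^∞`, with the cylinders `Z(γ)` as a basis. -/
instance : TopologicalSpace T.InfPath :=
  TopologicalSpace.generateFrom (Set.range FinPath.cylinder)

/-! ### The inverse semigroup `S_{G,E}` -/

variable (T) in
/-- The nonzero elements of `S_{G,E}`: triples `(α, g, β)` with `s(α) = g s(β)`. -/
@[ext]
structure Triple where
  α : T.FinPath
  g : G
  β : T.FinPath
  source_eq : α.source = g • β.source

variable (T) in
/-- The inverse semigroup `S_{G,E}`: the triples together with a zero. -/
inductive SGE where
  | zero : SGE
  | of (t : T.Triple) : SGE

instance : Zero T.SGE := ⟨.zero⟩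

open Classical in
/-- The product of `(α, g, β)` and `(γ, h, δ)`: it is `(α (g ε), φ(g, ε) h, δ)` if `γ = β ε`,
`(α, g φ(h⁻¹, ε)⁻¹, δ (h⁻¹ ε))` if `β = γ ε`, and zero otherwise. -/
noncomputable def Triple.mul (t u : T.Triple) : T.SGE :=
  if H : t.β.IsPrefix u.α then
    .of
      { α := t.α.append ((t.β.rest u.α H).act t.g)
          (FinPath.range_act_rest _ _ _ _ _ t.source_eq.symm)
        g := (t.β.rest u.α H).coc t.g * u.g
        β := u.β
        source_eq := by
          rw [FinPath.source_append, FinPath.source_act, FinPath.source_rest, mul_smul,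
            u.source_eq] }
  else if H : u.α.IsPrefix t.β then
    .of
      { α := t.α
        g := t.g * ((u.α.rest t.β H).coc u.g⁻¹)⁻¹
        β := u.β.append ((u.α.rest t.β H).act u.g⁻¹)
          (FinPath.range_act_rest _ _ _ _ _ (by rw [u.source_eq, inv_smul_smul]))
        source_eq := by
          rw [FinPath.source_append, FinPath.source_act, FinPath.source_rest, mul_smul,
            inv_smul_smul, t.source_eq] }
  else .zero

noncomputable instance : Mul T.SGE where
  mul s t := match s, t with
    | .of t, .of u => t.mul u
    | _, _ => .zero

/-- `(α, g, β)* = (β, g⁻¹, α)`. -/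
instance : Star T.SGE where
  star s := match s with
    | .of t => .of ⟨t.β, t.g⁻¹, t.α, by rw [t.source_eq, inv_smul_smul]⟩
    | .zero => .zero

/-! ### The standard action on `E^∞` and topological freeness -/

/-- The standard action of `S_{G,E}` on `E^∞` by partial homeomorphisms, as a relation:
`Acts t ω ω'` says that `ω` lies in the domain of `t` and is mapped to `ω'`.  The element
`(α, g, β)` acts on `Z(β)` by `β η ↦ α (g η)`, and zero acts as the empty map. -/
def Acts : T.SGE → T.InfPath → T.InfPath → Prop
  | .of t, ω, ω' => ∃ (η : T.InfPath) (h : η.range = t.β.source)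
      (h' : (η.act t.g).range = t.α.source),
      ω = t.β.appendInf η h ∧ ω' = t.α.appendInf (η.act t.g) h'
  | .zero, _, _ => False

/-- The fixed points of `t`. -/
def fixedPoints (t : T.SGE) : Set T.InfPath := {ω | Acts t ω ω}

/-- The trivial fixed points of `t`: those in the domain of an idempotent `e ≤ t`. -/
def trivialFixedPoints (t : T.SGE) : Set T.InfPath :=
  {ω | ∃ e : T.SGE, e * e = e ∧ t * e = e ∧ ∃ ω', Acts e ω ω'}

variable (T) in
/-- The standard action `S_{G,E} ↷ E^∞` is topologically free: for every `t`, all interior points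
of the set of fixed points of `t` are trivial fixed points. -/
def TopologicallyFree : Prop :=
  ∀ t : T.SGE, interior (fixedPoints t) ⊆ trivialFixedPoints t

/-! ### The tight groupoid -/

variable (T) in
/-- The semilattice of idempotents of `S_{G,E}`. -/
def idem : Set T.SGE := {e | e * e = e}

/-- `E^{X,Y}`: the idempotents below all elements of `X` and orthogonal to all elements of `Y`. -/
def below (X Y : Set T.SGE) : Set T.SGE :=
  {e | e ∈ T.idem ∧ (∀ x ∈ X, e * x = e) ∧ ∀ y ∈ Y, e * y = 0}

/-- `Z` is a cover of the set `F` of idempotents: `Z ⊆ F`, and every nonzero element of `F`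
meets some element of `Z`. -/
def IsCover (Z F : Set T.SGE) : Prop :=
  Z ⊆ F ∧ ∀ f ∈ F, f ≠ 0 → ∃ z ∈ Z, z * f ≠ 0

/-- Filters in the semilattice of idempotents. -/
structure IsFilter (ξ : Set T.SGE) : Prop where
  subset : ξ ⊆ T.idem
  nonempty : ξ.Nonempty
  zero_notMem : (0 : T.SGE) ∉ ξ
  mul_mem : ∀ e ∈ ξ, ∀ f ∈ ξ, e * f ∈ ξ
  upward : ∀ e ∈ ξ, ∀ f ∈ T.idem, e * f = e → f ∈ ξ

/-- Tight filters in the semilattice of idempotents. -/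
def IsTight (ξ : Set T.SGE) : Prop :=
  IsFilter ξ ∧ ∀ X Y Z : Set T.SGE, X.Finite → Y.Finite → Z.Finite →
    X ⊆ T.idem → Y ⊆ T.idem → IsCover Z (below X Y) →
    X ⊆ ξ → Disjoint Y ξ → (Z ∩ ξ).Nonempty

variable (T) in
/-- The space of tight filters. -/
def TightSpectrum := {ξ : Set T.SGE // IsTight ξ}

/-- The topology of pointwise convergence of indicator functions of filters. -/
instance : TopologicalSpace T.TightSpectrum :=
  TopologicalSpace.generateFrom
    {U | ∃ e ∈ T.idem, U = {ξ | e ∈ ξ.1} ∨ U = {ξ | e ∉ ξ.1}}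

/-- The action of `S_{G,E}` on tight filters: for `t* t ∈ ξ`, the filter `t · ξ` consists of the
idempotents `f` with `t* f t ∈ ξ`. -/
def translate (t : T.SGE) (ξ : Set T.SGE) : Set T.SGE :=
  {f | f ∈ T.idem ∧ star t * f * t ∈ ξ}

variable (T) in
/-- Pairs `(t, ξ)` with `ξ` a tight filter in the domain of `t`. -/
structure GermRep where
  elt : T.SGE
  pt : T.TightSpectrum
  mem : star elt * elt ∈ pt.1

/-- `(t, ξ)` and `(u, ζ)` have the same germ: `ξ = ζ` and `t e = u e` for an idempotent
`e ∈ ξ`. -/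
def SameGerm (p q : T.GermRep) : Prop :=
  p.pt = q.pt ∧ ∃ e ∈ T.idem, e ∈ p.pt.1 ∧ p.elt * e = q.elt * e

variable (T) in
/-- (The space of arrows of) the tight groupoid: the germs `[t, ξ]` of the action of `S_{G,E}` on
its tight filters.  The source of `[t, ξ]` is `ξ` and its range is `t · ξ`. -/
def TightGroupoid := Quot (SameGerm (T := T))

/-- `Θ(t, U) = {[t, ξ] : ξ ∈ U, t* t ∈ ξ}`. -/
def Theta (t : T.SGE) (U : Set T.TightSpectrum) : Set T.TightGroupoid :=
  {γ | ∃ p : T.GermRep, p.elt = t ∧ p.pt ∈ U ∧ γ = Quot.mk _ p}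

/-- The topology of the tight groupoid, with the sets `Θ(t, U)`, `U` open, as a basis. -/
instance : TopologicalSpace T.TightGroupoid :=
  TopologicalSpace.generateFrom {W | ∃ (t : T.SGE) (U : Set T.TightSpectrum),
    IsOpen U ∧ W = Theta t U}

variable (T) in
/-- The unit space: the germs of idempotents. -/
def unitSpace : Set T.TightGroupoid :=
  {γ | ∃ p : T.GermRep, p.elt ∈ T.idem ∧ γ = Quot.mk _ p}

variable (T) in
/-- The isotropy group bundle: the germs whose range and source agree. -/
def isotropy : Set T.TightGroupoid :=
  {γ | ∃ p : T.GermRep, translate p.elt p.pt.1 = p.pt.1 ∧ γ = Quot.mk _ p}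

variable (T) in
/-- The tight groupoid is essentially principal: the interior of the isotropy group bundle is the
unit space. -/
def EssentiallyPrincipal : Prop := interior T.isotropy = T.unitSpace

/-! ### `G`-circuits and slackness -/

/-- `(g, γ)` is a `G`-circuit: `γ` has nonzero length and `s(γ) = g r(γ)`. -/
def IsGCircuit (g : G) (γ : T.FinPath) : Prop := γ.length ≠ 0 ∧ γ.source = g • γ.range

/-- The path `γ` has an entry: there is an edge `b` which has the same range as some edge `a`
of `γ`, but is different from `a`. -/
def HasEntry (γ : T.FinPath) : Prop := ∃ a ∈ γ.edges, ∃ b : A, T.rng b = T.rng a ∧ b ≠ a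

/-- `γ` is strongly fixed by `g`: `g γ = γ` and `φ(g, γ) = 1`. -/
def StronglyFixed (g : G) (γ : T.FinPath) : Prop := γ.act g = γ ∧ γ.coc g = 1

variable (T) in
/-- `g` is slack at `x`: all sufficiently long finite paths with range `x` are strongly fixed
by `g`. -/
def IsSlackAt (g : G) (x : V) : Prop :=
  ∃ n : ℕ, ∀ γ : T.FinPath, γ.range = x → n ≤ γ.length → StronglyFixed g γ

variable (T) in
/-- `g` fixes `Z(x)` pointwise. -/
def FixesCylinder (g : G) (x : V) : Prop :=
  ∀ ω ∈ (⟨x, [], trivial⟩ : T.FinPath).cylinder, ω.act g = ω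

end

end SelfSimilarGraph

/-! Everything is read off from infinite paths. Row-finiteness and the absence of sources make the
one-edge extensions of a path a finite cover, so a tight filter always contains a longer prefix and
is the filter of a unique infinite path (`exists_tight_eq`); `InfPath.tight` is a homeomorphism. The
germ of `t` at `ω` is isotropy iff `t` fixes `ω`, and a unit iff `ω` is trivially fixed
(`mk_germRep_mem_isotropy`, `mk_germRep_mem_unitSpace`). Since each `t` gives an open slice of
germs, topological freeness and essential principality say the same thing.

Necessity of the two conditions: a `G`-circuit `(g, γ)` without entry leaves only one infinite path
with range `r(γ)`; the element `(γ, g, r(γ))` fixes it, but not trivially, because it changes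
lengths. If `g` fixes `Z(x)` but is not slack at `x`, König's lemma gives an infinite path none of
whose prefixes is strongly fixed, and this path is an interior, nontrivial fixed point of `(x, g,
x)`.

Sufficiency: let `ω` be an interior fixed point of `(α, g, β)`. If `|α| > |β|`, the tail `η` of `ω`
after `β` satisfies `η.drop m = g η` with `m = |α| - |β|`, so its first `m` edges determine it. They
form a `G`-circuit, and the group action copies its entry arbitrarily far along `η`; branching off
there gives a second fixed point with the same first edges, a contradiction
(`notMem_interior_fixedPoints_of_length_lt`). The case `|α| < |β|` follows by taking adjoints. If
the lengths agree, then `α = β`, a restriction of the element has a group part fixing a whole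
cylinder, and slackness turns a further restriction into an idempotent. -/

namespace SelfSimilarGraph

/-! ### Finite and infinite paths, the group action on them, and the topology of `E^∞`. -/

section PathCalculus

variable {G V A : Type*} [Group G] [MulAction G V] [MulAction G A] {T : SelfSimilarGraph G V A}

/-! ### Words -/

lemma φ_one (a : A) : T.φ 1 a = 1 := by
  have h := T.φ_mul 1 1 a
  rw [one_smul, one_mul] at h
  exact left_eq_mul.1 h

lemma actList_one (l : List A) : T.actList 1 l = l := by
  induction l with
  | nil => rfl
  | cons a l ih => simp [actList, φ_one, ih]

lemma cocList_one (l : List A) : T.cocList 1 l = 1 := by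
  induction l with
  | nil => rfl
  | cons a l ih => simp [cocList, φ_one, ih]

lemma actList_append (g : G) (l m : List A) :
    T.actList g (l ++ m) = T.actList g l ++ T.actList (T.cocList g l) m := by
  induction l generalizing g with
  | nil => rfl
  | cons a l ih => simp [actList, cocList, ih]

lemma cocList_append (g : G) (l m : List A) :
    T.cocList g (l ++ m) = T.cocList (T.cocList g l) m := by
  induction l generalizing g with
  | nil => rfl
  | cons a l ih => simp [cocList, ih]

lemma actList_mul (g h : G) (l : List A) :
    T.actList (g * h) l = T.actList g (T.actList h l) := by
  induction l generalizing g h with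
  | nil => rfl
  | cons a l ih => simp [actList, mul_smul, T.φ_mul, ih]

@[simp] lemma length_actList (g : G) (l : List A) : (T.actList g l).length = l.length := by
  induction l generalizing g with
  | nil => rfl
  | cons a l ih => simp [actList, ih]

/-- Serves to carry the absence of entries from a path to its translates. -/
lemma exists_smul_of_mem_actList {g : G} {l : List A} {a : A} (h : a ∈ T.actList g l) :
    ∃ k : G, ∃ b ∈ l, a = k • b := by
  induction l generalizing g with
  | nil => simp [actList] at h
  | cons c l ih =>
    rcases List.mem_cons.1 h with rfl | h
    · exact ⟨g, c, by simp, rfl⟩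
    · obtain ⟨k, b, hb, rfl⟩ := ih h
      exact ⟨k, b, List.mem_cons_of_mem _ hb, rfl⟩

/-! ### Prefixes and tails of infinite paths -/

/-- The first `n` edges of an infinite path. -/
def InfPath.word (ω : T.InfPath) (n : ℕ) : List A := (List.range n).map ω.edge

@[simp] lemma InfPath.length_word (ω : T.InfPath) (n : ℕ) : (ω.word n).length = n := by
  simp [InfPath.word]

lemma InfPath.word_zero (ω : T.InfPath) : ω.word 0 = [] := rfl

lemma InfPath.word_succ (ω : T.InfPath) (n : ℕ) : ω.word (n + 1) = ω.word n ++ [ω.edge n] := by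
  simp [InfPath.word, List.range_succ]

lemma InfPath.isPathFrom_word (ω : T.InfPath) (n : ℕ) :
    T.IsPathFrom ω.range (ω.word n) ∧ T.srcFrom ω.range (ω.word n) = T.rng (ω.edge n) := by
  induction n with
  | zero => exact ⟨trivial, rfl⟩
  | succ n ih =>
    rw [ω.word_succ, T.isPathFrom_append, T.srcFrom_append, ih.2]
    exact ⟨⟨ih.1, rfl, trivial⟩, ω.isPath n⟩

/-- The prefix of length `n` of an infinite path. -/
def InfPath.take (ω : T.InfPath) (n : ℕ) : T.FinPath := ⟨ω.range, ω.word n, (ω.isPathFrom_word n).1⟩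

/-- An infinite path without its first `n` edges. -/
def InfPath.drop (ω : T.InfPath) (n : ℕ) : T.InfPath := ⟨fun k => ω.edge (n + k), fun _ => ω.isPath _⟩

@[simp] lemma InfPath.length_take (ω : T.InfPath) (n : ℕ) : (ω.take n).length = n :=
  ω.length_word n

lemma InfPath.source_take (ω : T.InfPath) (n : ℕ) : (ω.take n).source = (ω.drop n).range :=
  (ω.isPathFrom_word n).2

lemma InfPath.word_add (ω : T.InfPath) (m n : ℕ) :
    ω.word (m + n) = ω.word m ++ (ω.drop m).word n := by
  simp [InfPath.word, List.range_add, InfPath.drop, Function.comp_def]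

lemma InfPath.drop_drop (ω : T.InfPath) (m n : ℕ) : (ω.drop m).drop n = ω.drop (m + n) := by
  ext k; simp [InfPath.drop, add_assoc]

lemma appendSeq_add (l : List A) (a : ℕ → A) (n : ℕ) : appendSeq l a (l.length + n) = a n := by
  induction l with
  | nil => simp [appendSeq]
  | cons b l ih => rw [List.length_cons, add_right_comm]; exact ih

lemma map_appendSeq (l : List A) (a : ℕ → A) : (List.range l.length).map (appendSeq l a) = l := by
  induction l with
  | nil => rfl
  | cons b l ih =>
    rw [List.length_cons, List.range_succ_eq_map]
    simpa [appendSeq, Function.comp_def] using ih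

lemma InfPath.ext_take_drop {ω ω' : T.InfPath} {n : ℕ} (h : ω.word n = ω'.word n)
    (h' : ω.drop n = ω'.drop n) : ω = ω' := by
  ext k
  rcases lt_or_ge k n with hk | hk
  · exact List.map_inj_left.1 h k (List.mem_range.2 hk)
  · obtain ⟨j, rfl⟩ := Nat.exists_eq_add_of_le hk
    exact congrArg (fun η : T.InfPath => η.edge j) h'

lemma FinPath.word_appendInf (γ : T.FinPath) (η : T.InfPath) (h : η.range = γ.source) :
    (γ.appendInf η h).word γ.length = γ.edges := map_appendSeq _ _

lemma FinPath.range_appendInf (γ : T.FinPath) (η : T.InfPath) (h : η.range = γ.source) :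
    (γ.appendInf η h).range = γ.range := (T.appendSeq_isPath η γ.edges γ.range γ.isPath h).1

lemma FinPath.take_appendInf (γ : T.FinPath) (η : T.InfPath) (h : η.range = γ.source) :
    (γ.appendInf η h).take γ.length = γ :=
  FinPath.ext (γ.range_appendInf η h) (γ.word_appendInf η h)

lemma FinPath.drop_appendInf (γ : T.FinPath) (η : T.InfPath) (h : η.range = γ.source) :
    (γ.appendInf η h).drop γ.length = η := by
  ext k; exact appendSeq_add _ _ _

/-- The tail is recovered as `ω.drop γ.length`, so the existential in the definition reduces to an
equation of finite paths. -/
lemma FinPath.mem_cylinder {γ : T.FinPath} {ω : T.InfPath} :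
    ω ∈ γ.cylinder ↔ ω.take γ.length = γ := by
  constructor
  · rintro ⟨η, h, rfl⟩; exact γ.take_appendInf η h
  · intro h
    have h' : (ω.drop γ.length).range = γ.source := by rw [← ω.source_take, h]
    refine ⟨_, h', InfPath.ext_take_drop (n := γ.length) ?_ ?_⟩
    · rw [γ.word_appendInf]; exact congrArg FinPath.edges h
    · rw [γ.drop_appendInf]

lemma InfPath.mem_cylinder_take (ω : T.InfPath) (n : ℕ) : ω ∈ (ω.take n).cylinder := by
  rw [FinPath.mem_cylinder, ω.length_take]

lemma InfPath.range_eq_of_take_eq {ω ω' : T.InfPath} {n : ℕ} (h : ω.take n = ω'.take n) :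
    ω.range = ω'.range := congrArg FinPath.range h

lemma InfPath.take_eq_of_le {ω ω' : T.InfPath} {m n : ℕ} (hmn : m ≤ n) (h : ω.take n = ω'.take n) :
    ω.take m = ω'.take m := by
  refine FinPath.ext (InfPath.range_eq_of_take_eq h) ?_
  have h' : ω.word n = ω'.word n := congrArg FinPath.edges h
  obtain ⟨k, rfl⟩ := Nat.exists_eq_add_of_le hmn
  rw [ω.word_add, ω'.word_add] at h'
  exact (List.append_inj h' (by simp)).1

lemma InfPath.mem_cylinder_iff_take_eq {ω ω' : T.InfPath} {n : ℕ} :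
    ω' ∈ (ω.take n).cylinder ↔ ω'.take n = ω.take n := by
  rw [FinPath.mem_cylinder, ω.length_take]

lemma FinPath.mem_cylinder_nil {x : V} {ω : T.InfPath} :
    ω ∈ (⟨x, [], trivial⟩ : T.FinPath).cylinder ↔ ω.range = x := by
  rw [FinPath.mem_cylinder]
  exact ⟨fun h => congrArg FinPath.range h, fun h => FinPath.ext h rfl⟩

/-! ### The action on prefixes and tails -/

/-- Reconciles two recursions: `cocSeq` grows at the end of the word, `cocList` consumes it from the
front. -/
lemma cocSeq_eq_cocList (g : G) (ω : T.InfPath) (n : ℕ) :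
    T.cocSeq g ω.edge n = T.cocList g (ω.word n) := by
  induction n with
  | zero => rfl
  | succ n ih => rw [ω.word_succ, cocList_append, ← ih]; rfl

lemma InfPath.range_act (g : G) (ω : T.InfPath) : (ω.act g).range = g • ω.range :=
  T.rng_smul _ _

lemma InfPath.word_act (g : G) (ω : T.InfPath) (n : ℕ) :
    (ω.act g).word n = T.actList g (ω.word n) := by
  induction n with
  | zero => rfl
  | succ n ih =>
    rw [InfPath.word_succ, InfPath.word_succ, actList_append, ih, ← cocSeq_eq_cocList]; rfl

lemma cocSeq_add (g : G) (a : ℕ → A) (m n : ℕ) :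
    T.cocSeq g a (m + n) = T.cocSeq (T.cocSeq g a m) (fun k => a (m + k)) n := by
  induction n with
  | zero => rfl
  | succ n ih => rw [← add_assoc, cocSeq, ih, cocSeq]

lemma InfPath.drop_act (g : G) (ω : T.InfPath) (n : ℕ) :
    (ω.act g).drop n = (ω.drop n).act (T.cocList g (ω.word n)) := by
  ext k
  change T.cocSeq g ω.edge (n + k) • ω.edge (n + k) = _
  rw [cocSeq_add, cocSeq_eq_cocList]
  rfl

lemma InfPath.ext_word {ω ω' : T.InfPath} (h : ∀ n, ω.word n = ω'.word n) : ω = ω' := by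
  ext k
  have := h (k + 1)
  rw [InfPath.word_succ, InfPath.word_succ] at this
  simpa using (List.append_inj this (by simp)).2

lemma InfPath.act_mul (g h : G) (ω : T.InfPath) : ω.act (g * h) = (ω.act h).act g :=
  InfPath.ext_word fun n => by simp only [InfPath.word_act, actList_mul]

lemma InfPath.act_one (ω : T.InfPath) : ω.act (1 : G) = ω :=
  InfPath.ext_word fun n => by simp only [InfPath.word_act, actList_one]

lemma InfPath.act_inv_act (g : G) (ω : T.InfPath) : (ω.act g).act g⁻¹ = ω := by
  rw [← InfPath.act_mul, inv_mul_cancel, InfPath.act_one]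

lemma InfPath.act_act_inv (g : G) (ω : T.InfPath) : (ω.act g⁻¹).act g = ω := by
  rw [← InfPath.act_mul, mul_inv_cancel, InfPath.act_one]

/-! ### Extending finite paths -/

/-- The path `δ a`. -/
def FinPath.snoc (δ : T.FinPath) (a : A) (h : T.rng a = δ.source) : T.FinPath :=
  ⟨δ.range, δ.edges ++ [a], T.isPathFrom_append.2 ⟨δ.isPath, h, trivial⟩⟩

lemma FinPath.source_snoc (δ : T.FinPath) (a : A) (h : T.rng a = δ.source) :
    (δ.snoc a h).source = T.src a := by
  simp [FinPath.snoc, FinPath.source, srcFrom_append, srcFrom]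

/-- König's lemma: a property of finite paths which can always be propagated along a further edge
holds along an infinite path. -/
lemma exists_infPath_of_step {P : T.FinPath → Prop}
    (step : ∀ δ, P δ → ∃ (a : A) (h : T.rng a = δ.source), P (δ.snoc a h))
    (δ₀ : T.FinPath) (h₀ : P δ₀) :
    ∃ ω ∈ δ₀.cylinder, ∀ k, P (ω.take (δ₀.length + k)) := by
  choose a ha hP using step
  let next : {δ // P δ} → {δ // P δ} := fun δ => ⟨δ.1.snoc (a δ.1 δ.2) (ha δ.1 δ.2), hP δ.1 δ.2⟩
  let δ : ℕ → {δ // P δ} := fun k => Nat.rec ⟨δ₀, h₀⟩ (fun _ => next) k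
  -- The edges chosen along the iteration; `key` below says that `δ k` is `δ₀` followed by the first
  -- `k` of them.
  let η : T.InfPath := ⟨fun k => a (δ k).1 (δ k).2, fun n => by
    rw [ha _ (δ (n + 1)).2]
    exact (FinPath.source_snoc _ _ (ha _ (δ n).2)).symm⟩
  have hη : η.range = δ₀.source := ha _ h₀
  refine ⟨δ₀.appendInf η hη, ⟨η, hη, rfl⟩, fun k => ?_⟩
  have key : ∀ k, (δ k).1.range = δ₀.range ∧ (δ k).1.edges = δ₀.edges ++ η.word k := by
    intro k
    induction k with
    | zero => exact ⟨rfl, by simp [InfPath.word_zero, δ]⟩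
    | succ k ih =>
      refine ⟨ih.1, ?_⟩
      rw [η.word_succ, ← List.append_assoc, ← ih.2]
      rfl
  have : (δ₀.appendInf η hη).take (δ₀.length + k) = (δ k).1 := by
    refine FinPath.ext ?_ ?_
    · rw [(key k).1]; exact δ₀.range_appendInf η hη
    · rw [(key k).2]
      change InfPath.word _ _ = _
      rw [InfPath.word_add, δ₀.drop_appendInf, δ₀.word_appendInf]
  rw [this]
  exact (δ k).2

lemma NoSources.exists_mem_cylinder (hsrc : T.NoSources) (δ : T.FinPath) :
    ∃ ω, ω ∈ δ.cylinder := by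
  obtain ⟨ω, hω, -⟩ := exists_infPath_of_step (P := fun _ : T.FinPath => True)
    (fun δ _ => (hsrc δ.source).imp fun a h => ⟨h, trivial⟩) δ trivial
  exact ⟨ω, hω⟩

/-! ### The topology of `E^∞` -/

lemma FinPath.isOpen_cylinder (γ : T.FinPath) : IsOpen γ.cylinder :=
  TopologicalSpace.isOpen_generateFrom_of_mem ⟨γ, rfl⟩

/-- The cylinders of the prefixes of `ω` decrease, so a finite intersection only asks for a larger
bound; the form "for all large `n`" lets several such bounds be met at once. -/
lemma exists_cylinder_take_subset {U : Set T.InfPath} (hU : IsOpen U) {ω : T.InfPath}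
    (hω : ω ∈ U) : ∃ N, ∀ n ≥ N, (ω.take n).cylinder ⊆ U := by
  induction hU with
  | basic s hs =>
    obtain ⟨γ, rfl⟩ := hs
    refine ⟨γ.length, fun n hn ω' h => ?_⟩
    rw [InfPath.mem_cylinder_iff_take_eq] at h
    rw [FinPath.mem_cylinder] at hω ⊢
    rw [InfPath.take_eq_of_le hn h, hω]
  | univ => exact ⟨0, fun _ _ => Set.subset_univ _⟩
  | inter s t _ _ hs ht =>
    obtain ⟨N, hN⟩ := hs hω.1
    obtain ⟨M, hM⟩ := ht hω.2
    exact ⟨max N M, fun n hn => Set.subset_inter (hN n (le_of_max_le_left hn))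
      (hM n (le_of_max_le_right hn))⟩
  | sUnion S _ ih =>
    obtain ⟨s, hs, hωs⟩ := hω
    obtain ⟨N, hN⟩ := ih s hs hωs
    exact ⟨N, fun n hn => (hN n hn).trans (Set.subset_sUnion_of_mem hs)⟩

lemma isOpen_of_cylinder_take_subset {U : Set T.InfPath}
    (h : ∀ ω ∈ U, ∃ n, (ω.take n).cylinder ⊆ U) : IsOpen U := by
  rw [isOpen_iff_forall_mem_open]
  intro ω hω
  obtain ⟨n, hn⟩ := h ω hω
  exact ⟨_, hn, FinPath.isOpen_cylinder _, ω.mem_cylinder_take n⟩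

/-- Membership depends only on the first `|γ|` edges. Needed because the topology on filters also
has the sets `e ∉ ξ` as generators. -/
lemma FinPath.isOpen_compl_cylinder (γ : T.FinPath) : IsOpen γ.cylinderᶜ := by
  refine isOpen_of_cylinder_take_subset fun ω hω => ⟨γ.length, fun ω' h hγ => hω ?_⟩
  rw [InfPath.mem_cylinder_iff_take_eq] at h
  rw [FinPath.mem_cylinder] at hγ ⊢
  rw [← h, hγ]

end PathCalculus

/-! ### Multiplication in `S_{G,E}`, its idempotents, and the standard action. -/

section Products

variable {G V A : Type*} [Group G] [MulAction G V] [MulAction G A] {T : SelfSimilarGraph G V A}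

/-! ### Products in `S_{G,E}` -/

lemma of_inj {t u : T.Triple} : SGE.of t = SGE.of u ↔ t = u := by
  constructor
  · intro h; injection h
  · rintro rfl; rfl

lemma zero_mul' (s : T.SGE) : 0 * s = 0 := rfl

lemma mul_zero' (s : T.SGE) : s * 0 = 0 := by cases s <;> rfl

lemma of_ne_zero (t : T.Triple) : SGE.of t ≠ 0 := nofun

lemma of_mul_of (t u : T.Triple) : SGE.of t * SGE.of u = t.mul u := rfl

lemma FinPath.edges_rest {γ β : T.FinPath} (h : γ.IsPrefix β) {l : List A}
    (hl : γ.edges ++ l = β.edges) : (γ.rest β h).edges = l := by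
  simp [FinPath.rest, ← hl]

/-- The product rule with the remaining word `l` given explicitly instead of through `rest`. -/
lemma of_mul_of_extend {t u v : T.Triple} (l : List A) (hr : t.β.range = u.α.range)
    (hl : t.β.edges ++ l = u.α.edges) (hαr : v.α.range = t.α.range)
    (hαe : v.α.edges = t.α.edges ++ T.actList t.g l) (hg : v.g = T.cocList t.g l * u.g)
    (hβ : v.β = u.β) : SGE.of t * SGE.of u = SGE.of v := by
  have H : t.β.IsPrefix u.α := ⟨hr, l, hl⟩
  rw [of_mul_of, Triple.mul, dif_pos H, of_inj]
  refine Triple.ext (FinPath.ext hαr.symm ?_) ?_ hβ.symm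
  · rw [hαe]
    simp only [FinPath.append, FinPath.act, FinPath.edges_rest H hl]
  · rw [hg]
    simp only [FinPath.coc, FinPath.edges_rest H hl]

lemma of_mul_of_extend' {t u v : T.Triple} (l : List A) (hr : u.α.range = t.β.range)
    (hl : u.α.edges ++ l = t.β.edges) (hα : v.α = t.α)
    (hg : v.g = t.g * (T.cocList u.g⁻¹ l)⁻¹) (hβr : v.β.range = u.β.range)
    (hβe : v.β.edges = u.β.edges ++ T.actList u.g⁻¹ l) : SGE.of t * SGE.of u = SGE.of v := by
  have H : u.α.IsPrefix t.β := ⟨hr, l, hl⟩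
  -- When both prefix relations hold, `Triple.mul` takes its first branch; then `l = []` and the two
  -- formulas agree.
  by_cases H' : t.β.IsPrefix u.α
  · obtain ⟨-, m, hm⟩ := H'
    have hl0 : l = [] := by
      rw [← hm, List.append_assoc] at hl
      have := congrArg List.length hl
      simp only [List.length_append] at this
      exact List.length_eq_zero_iff.1 (by omega)
    subst hl0
    refine of_mul_of_extend [] hr.symm (by simpa using hl.symm) (by rw [hα]) ?_ ?_ ?_
    · simp [hα, actList]
    · simpa [cocList] using hg
    · exact FinPath.ext hβr (by simpa [actList] using hβe)
  · rw [of_mul_of, Triple.mul, dif_neg H', dif_pos H, of_inj]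
    refine Triple.ext hα.symm ?_ (FinPath.ext hβr.symm ?_)
    · rw [hg]
      simp only [FinPath.coc, FinPath.edges_rest H hl]
    · rw [hβe]
      simp only [FinPath.append, FinPath.act, FinPath.edges_rest H hl]

lemma of_mul_of_eq_zero {t u : T.Triple} (h : ¬ t.β.IsPrefix u.α) (h' : ¬ u.α.IsPrefix t.β) :
    SGE.of t * SGE.of u = 0 := by
  rw [of_mul_of, Triple.mul, dif_neg h, dif_neg h']; rfl

lemma of_mul_of_ne_zero {t u : T.Triple} :
    SGE.of t * SGE.of u ≠ 0 ↔ t.β.IsPrefix u.α ∨ u.α.IsPrefix t.β := by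
  constructor
  · intro h
    by_contra! H
    exact h (of_mul_of_eq_zero H.1 H.2)
  · intro h
    rw [of_mul_of, Triple.mul]
    split_ifs with h₁ h₂
    · exact of_ne_zero _
    · exact of_ne_zero _
    · exact (h.elim h₁ h₂).elim

/-- The idempotent `(δ, 1, δ)`. -/
def FinPath.proj (δ : T.FinPath) : T.SGE := .of ⟨δ, 1, δ, (one_smul _ _).symm⟩

lemma FinPath.proj_ne_zero (δ : T.FinPath) : δ.proj ≠ 0 := of_ne_zero _

lemma FinPath.proj_inj {δ ε : T.FinPath} : δ.proj = ε.proj ↔ δ = ε := by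
  constructor
  · intro h; exact congrArg Triple.α (of_inj.1 h)
  · rintro rfl; rfl

lemma FinPath.isPrefix_refl (δ : T.FinPath) : δ.IsPrefix δ := ⟨rfl, List.prefix_rfl⟩

lemma FinPath.IsPrefix.length_le {γ β : T.FinPath} (h : γ.IsPrefix β) : γ.length ≤ β.length :=
  h.2.length_le

lemma FinPath.IsPrefix.eq_of_length_le {γ β : T.FinPath} (h : γ.IsPrefix β)
    (h' : β.length ≤ γ.length) : γ = β :=
  FinPath.ext h.1 (h.2.eq_of_length_le h')

lemma of_mul_proj_of_isPrefix {t : T.Triple} {δ : T.FinPath} (h : δ.IsPrefix t.β) :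
    SGE.of t * δ.proj = SGE.of t := by
  obtain ⟨hr, l, hl⟩ := h
  exact of_mul_of_extend' l hr hl rfl (by simp [cocList_one]) hr.symm
    (by simp [actList_one, hl])

lemma proj_mul_of_of_isPrefix {t : T.Triple} {δ : T.FinPath} (h : δ.IsPrefix t.α) :
    δ.proj * SGE.of t = SGE.of t := by
  obtain ⟨hr, l, hl⟩ := h
  exact of_mul_of_extend l hr hl hr.symm (by simp [actList_one, hl]) (by simp [cocList_one]) rfl

lemma proj_mul_proj_of_isPrefix {γ δ : T.FinPath} (h : γ.IsPrefix δ) :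
    δ.proj * γ.proj = δ.proj := of_mul_proj_of_isPrefix h

lemma proj_mul_proj_of_isPrefix' {γ δ : T.FinPath} (h : γ.IsPrefix δ) :
    γ.proj * δ.proj = δ.proj := proj_mul_of_of_isPrefix h

lemma proj_mul_proj_ne_zero {γ δ : T.FinPath} :
    γ.proj * δ.proj ≠ 0 ↔ γ.IsPrefix δ ∨ δ.IsPrefix γ := of_mul_of_ne_zero

lemma proj_mul_proj_eq_left {γ δ : T.FinPath} : δ.proj * γ.proj = δ.proj ↔ γ.IsPrefix δ := by
  refine ⟨fun h => ?_, proj_mul_proj_of_isPrefix⟩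
  have h0 : δ.proj * γ.proj ≠ 0 := by rw [h]; exact δ.proj_ne_zero
  rcases proj_mul_proj_ne_zero.1 h0 with h1 | h1
  · rw [proj_mul_proj_of_isPrefix' h1, FinPath.proj_inj] at h
    rw [h]; exact δ.isPrefix_refl
  · exact h1

lemma proj_mem_idem (δ : T.FinPath) : δ.proj ∈ T.idem :=
  proj_mul_proj_of_isPrefix δ.isPrefix_refl

/-- If `t t = t ≠ 0`, one of `α`, `β` extends the other by a word `l`. Comparing lengths in the
product forces `l = []`, hence `α = β`, and then `g g = g` gives `g = 1`. -/
lemma mem_idem {e : T.SGE} : e ∈ T.idem ↔ e = 0 ∨ ∃ δ : T.FinPath, e = δ.proj := by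
  constructor
  · intro h
    cases e with
    | zero => exact .inl rfl
    | of t =>
      refine .inr ⟨t.α, ?_⟩
      have h : SGE.of t * SGE.of t = SGE.of t := h
      have h0 : SGE.of t * SGE.of t ≠ 0 := by rw [h]; exact of_ne_zero t
      rcases of_mul_of_ne_zero.1 h0 with H | H
      · rw [of_mul_of, Triple.mul, dif_pos H, of_inj] at h
        obtain ⟨hr, l, hl⟩ := H
        have h1 := congrArg (fun u : T.Triple => u.α.edges) h
        have h2 := congrArg (fun u : T.Triple => u.g) h
        simp only [FinPath.append, FinPath.act, FinPath.coc,
          FinPath.edges_rest ⟨hr, l, hl⟩ hl] at h1 h2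
        have hl0 : l = [] := by
          have := congrArg List.length h1
          simp only [List.length_append, length_actList] at this
          exact List.length_eq_zero_iff.1 (by omega)
        subst hl0
        refine of_inj.2 (Triple.ext rfl ?_ (FinPath.ext hr (by simpa using hl)))
        simpa [cocList] using h2
      · by_cases H' : t.β.IsPrefix t.α
        · have heq := H.eq_of_length_le H'.length_le
          rw [of_mul_of, Triple.mul, dif_pos H', of_inj] at h
          have h2 := congrArg (fun u : T.Triple => u.g) h
          simp only [FinPath.coc, FinPath.edges_rest H' (l := []) (by simp [heq])] at h2
          exact of_inj.2 (Triple.ext rfl (by simpa [cocList] using h2) heq.symm)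
        · rw [of_mul_of, Triple.mul, dif_neg H', dif_pos H, of_inj] at h
          obtain ⟨hr, l, hl⟩ := H
          have h1 := congrArg (fun u : T.Triple => u.β.edges) h
          simp only [FinPath.append, FinPath.act,
            FinPath.edges_rest ⟨hr, l, hl⟩ hl] at h1
          have hl0 : l = [] := by
            have := congrArg List.length h1
            simp only [List.length_append, length_actList] at this
            exact List.length_eq_zero_iff.1 (by omega)
          subst hl0
          -- With `l = []` the two paths coincide, so the first branch would have applied.
          exact (H' ⟨hr.symm, by simp at hl; simp [hl]⟩).elim
  · rintro (rfl | ⟨δ, rfl⟩)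
    · rfl
    · exact proj_mem_idem δ

lemma star_mul_self (t : T.Triple) : star (SGE.of t) * SGE.of t = t.β.proj :=
  of_mul_of_extend [] rfl (by simp) rfl (by simp [actList])
    (by simp [cocList]) rfl

/-! ### Prefixes of an infinite path -/

lemma FinPath.IsPrefix.mem_cylinder {γ δ : T.FinPath} (h : γ.IsPrefix δ) {ω : T.InfPath}
    (hω : ω ∈ δ.cylinder) : ω ∈ γ.cylinder := by
  rw [FinPath.mem_cylinder] at hω ⊢
  have hr : ω.range = δ.range := congrArg FinPath.range hω
  have he : ω.word δ.length = δ.edges := congrArg FinPath.edges hω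
  obtain ⟨hr', l, hl⟩ := h
  refine FinPath.ext (hr.trans hr'.symm) ?_
  have hlen : δ.length = γ.length + l.length := by
    simp [FinPath.length, ← hl]
  rw [hlen, ω.word_add, ← hl] at he
  exact (List.append_inj he (by simp [FinPath.length])).1

lemma InfPath.isPrefix_take {ω : T.InfPath} {γ : T.FinPath} (hω : ω ∈ γ.cylinder) {n : ℕ}
    (hn : γ.length ≤ n) : γ.IsPrefix (ω.take n) := by
  rw [FinPath.mem_cylinder] at hω
  obtain ⟨k, rfl⟩ := Nat.exists_eq_add_of_le hn
  refine ⟨(congrArg FinPath.range hω).symm, (ω.drop γ.length).word k, ?_⟩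
  change _ = ω.word _
  rw [ω.word_add]
  congr 1
  exact (congrArg FinPath.edges hω).symm

lemma FinPath.isPrefix_of_mem_cylinder {γ δ : T.FinPath} {ω : T.InfPath} (hγ : ω ∈ γ.cylinder)
    (hδ : ω ∈ δ.cylinder) (h : γ.length ≤ δ.length) : γ.IsPrefix δ := by
  have := ω.isPrefix_take hγ h
  rwa [FinPath.mem_cylinder.1 hδ] at this

/-- The restriction of `(α, g, β)` to `Z(β l)`, namely `(α (g l), φ(g, l), β l)`. -/
def Triple.restrict (t : T.Triple) (l : List A) (hl : T.IsPathFrom t.β.source l) : T.Triple where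
  α := ⟨t.α.range, t.α.edges ++ T.actList t.g l, T.isPathFrom_append.2 ⟨t.α.isPath, by
    have := T.isPathFrom_actList t.g hl
    rwa [← t.source_eq] at this⟩⟩
  g := T.cocList t.g l
  β := ⟨t.β.range, t.β.edges ++ l, T.isPathFrom_append.2 ⟨t.β.isPath, hl⟩⟩
  source_eq := by
    simp only [FinPath.source, srcFrom_append]
    have h := t.source_eq
    simp only [FinPath.source] at h
    rw [h, srcFrom_actList]

lemma of_mul_proj_eq_restrict {t : T.Triple} {δ : T.FinPath} {l : List A} (hr : t.β.range = δ.range)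
    (hl : t.β.edges ++ l = δ.edges) :
    ∃ h, SGE.of t * δ.proj = SGE.of (t.restrict l h) := by
  have h : T.IsPathFrom t.β.source l := by
    have := δ.isPath
    rw [← hl, ← hr] at this
    exact (T.isPathFrom_append.1 this).2
  exact ⟨h, of_mul_of_extend l hr hl rfl rfl (by simp [Triple.restrict])
    (FinPath.ext hr hl)⟩

/-- The instance of associativity needed to shrink the idempotent that witnesses an equality of
germs: restricting in two stages is restricting once. -/
lemma of_mul_proj_mul_proj {t : T.Triple} {γ δ : T.FinPath} (hγδ : γ.IsPrefix δ)
    (htδ : t.β.IsPrefix δ) : SGE.of t * γ.proj * δ.proj = SGE.of t * δ.proj := by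
  have hδ : ∀ m, t.β.edges ++ m = γ.edges → t.β.range = γ.range →
      SGE.of t * γ.proj * δ.proj = SGE.of t * δ.proj := by
    intro m hm hr
    obtain ⟨hr', n, hn⟩ := hγδ
    obtain ⟨h, e⟩ := of_mul_proj_eq_restrict hr hm
    obtain ⟨h', e'⟩ := of_mul_proj_eq_restrict (t := t) (δ := δ) (l := m ++ n)
      (hr.trans hr') (by rw [← List.append_assoc, hm, hn])
    rw [e, e']
    refine of_mul_of_extend n (hr.trans hr') ?_ rfl ?_ ?_ ?_
    · simp [Triple.restrict, hm, hn]
    · simp [Triple.restrict, actList_append]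
    · simp [Triple.restrict, cocList_append]
    · refine FinPath.ext (hr.trans hr') ?_
      simp [Triple.restrict, ← hn, ← hm]
  rcases List.prefix_or_prefix_of_prefix hγδ.2 htδ.2 with h | h
  · rw [of_mul_proj_of_isPrefix ⟨hγδ.1.trans htδ.1.symm, h⟩]
  · obtain ⟨m, hm⟩ := h
    exact hδ m hm (htδ.1.trans hγδ.1.symm)

/-! ### The standard action -/

lemma acts_of_iff {t : T.Triple} {ω ω' : T.InfPath} :
    Acts (SGE.of t) ω ω' ↔ ω ∈ t.β.cylinder ∧ ω' ∈ t.α.cylinder ∧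
      ω'.drop t.α.length = (ω.drop t.β.length).act t.g := by
  constructor
  · rintro ⟨η, h, h', rfl, rfl⟩
    exact ⟨⟨η, h, rfl⟩, ⟨_, h', rfl⟩, by rw [FinPath.drop_appendInf, FinPath.drop_appendInf]⟩
  · rintro ⟨⟨η, h, rfl⟩, ⟨η', h', rfl⟩, e⟩
    rw [FinPath.drop_appendInf, FinPath.drop_appendInf] at e
    subst e
    exact ⟨η, h, h', rfl, rfl⟩

lemma not_acts_zero {ω ω' : T.InfPath} : ¬ Acts (0 : T.SGE) ω ω' := id

lemma exists_acts_of {t : T.Triple} {ω : T.InfPath} (hω : ω ∈ t.β.cylinder) :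
    ∃ ω', Acts (SGE.of t) ω ω' := by
  obtain ⟨η, h, rfl⟩ := hω
  exact ⟨_, η, h, by rw [InfPath.range_act, h, t.source_eq], rfl, rfl⟩

lemma Acts.unique {t : T.SGE} {ω ω₁ ω₂ : T.InfPath} (h₁ : Acts t ω ω₁) (h₂ : Acts t ω ω₂) :
    ω₁ = ω₂ := by
  cases t with
  | zero => exact h₁.elim
  | of t =>
    rw [acts_of_iff] at h₁ h₂
    refine InfPath.ext_take_drop (n := t.α.length) ?_ (h₁.2.2.trans h₂.2.2.symm)
    exact congrArg FinPath.edges ((FinPath.mem_cylinder.1 h₁.2.1).trans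
      (FinPath.mem_cylinder.1 h₂.2.1).symm)

lemma acts_proj_iff {δ : T.FinPath} {ω ω' : T.InfPath} :
    Acts δ.proj ω ω' ↔ ω ∈ δ.cylinder ∧ ω' = ω := by
  constructor
  · intro h
    have hω : ω ∈ δ.cylinder := (acts_of_iff.1 h).1
    refine ⟨hω, h.unique ?_⟩
    exact acts_of_iff.2 ⟨hω, hω, (InfPath.act_one _).symm⟩
  · rintro ⟨hω, rfl⟩
    exact acts_of_iff.2 ⟨hω, hω, (InfPath.act_one _).symm⟩

lemma acts_star_iff {t : T.SGE} {ω ω' : T.InfPath} : Acts (star t) ω' ω ↔ Acts t ω ω' := by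
  cases t with
  | zero => exact Iff.rfl
  | of t =>
    change Acts (SGE.of _) _ _ ↔ _
    rw [acts_of_iff, acts_of_iff]
    constructor
    · rintro ⟨h₁, h₂, h₃⟩
      refine ⟨h₂, h₁, ?_⟩
      simp only at h₃
      rw [h₃, InfPath.act_act_inv]
    · rintro ⟨h₁, h₂, h₃⟩
      refine ⟨h₂, h₁, ?_⟩
      simp only
      rw [h₃, InfPath.act_inv_act]

lemma mem_trivialFixedPoints {t : T.SGE} {ω : T.InfPath} :
    ω ∈ trivialFixedPoints t ↔ ∃ δ : T.FinPath, t * δ.proj = δ.proj ∧ ω ∈ δ.cylinder := by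
  constructor
  · rintro ⟨e, he, hte, ω', h⟩
    rcases mem_idem.1 he with rfl | ⟨δ, rfl⟩
    · exact (not_acts_zero h).elim
    · exact ⟨δ, hte, (acts_proj_iff.1 h).1⟩
  · rintro ⟨δ, h, hω⟩
    exact ⟨_, proj_mem_idem δ, h, ω, acts_proj_iff.2 ⟨hω, rfl⟩⟩

/-- If `β` is a prefix of `δ`, then `(α, g, β)` acts on `Z(δ)` in the same way as its restriction. -/
lemma acts_of_mul_proj_iff {t : T.Triple} {δ : T.FinPath} (h : t.β.IsPrefix δ) {ω ω' : T.InfPath}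
    (hω : ω ∈ δ.cylinder) : Acts (SGE.of t * δ.proj) ω ω' ↔ Acts (SGE.of t) ω ω' := by
  have mp : ∀ ω', Acts (SGE.of t * δ.proj) ω ω' → Acts (SGE.of t) ω ω' := by
    intro ω' H
    have hωβ := h.mem_cylinder hω
    obtain ⟨hr, l, hl⟩ := h
    obtain ⟨hp, e⟩ := of_mul_proj_eq_restrict hr hl
    rw [e, acts_of_iff] at H
    have hα : t.α.IsPrefix (t.restrict l hp).α := ⟨rfl, _, rfl⟩
    obtain ⟨h₁, h₂, h₃⟩ := H
    refine acts_of_iff.2 ⟨hωβ, hα.mem_cylinder h₂, ?_⟩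
    have hlα : (t.restrict l hp).α.length = t.α.length + l.length := by
      simp [Triple.restrict, FinPath.length]
    have hlβ : (t.restrict l hp).β.length = t.β.length + l.length := by
      simp [Triple.restrict, FinPath.length]
    have w₁ : (ω.drop t.β.length).word l.length = l := by
      have := congrArg FinPath.edges (FinPath.mem_cylinder.1 h₁)
      rw [hlβ] at this
      change ω.word _ = t.β.edges ++ l at this
      rw [ω.word_add] at this
      exact (List.append_inj this (by simp [FinPath.length])).2
    have w₂ : (ω'.drop t.α.length).word l.length = T.actList t.g l := by
      have := congrArg FinPath.edges (FinPath.mem_cylinder.1 h₂)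
      rw [hlα] at this
      change ω'.word _ = t.α.edges ++ T.actList t.g l at this
      rw [ω'.word_add] at this
      exact (List.append_inj this (by simp [FinPath.length])).2
    refine InfPath.ext_take_drop (n := l.length) ?_ ?_
    · rw [w₂, InfPath.word_act, w₁]
    · rw [InfPath.drop_drop, InfPath.drop_act, w₁, InfPath.drop_drop, ← hlα, ← hlβ, h₃]
      rfl
  -- The converse needs no computation: the restriction is defined at `ω`, and by `mp` its value
  -- there is a value of `t`, which is unique.
  refine ⟨mp ω', fun H => ?_⟩
  obtain ⟨hr, l, hl⟩ := h
  obtain ⟨hp, e⟩ := of_mul_proj_eq_restrict hr hl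
  have hβ : (t.restrict l hp).β = δ := FinPath.ext hr hl
  obtain ⟨ω'', H''⟩ := exists_acts_of (t := t.restrict l hp) (ω := ω) (by rwa [hβ])
  rw [← e] at H''
  rwa [← (mp _ H'').unique H]

end Products

/-! ### Topological freeness in terms of entries of `G`-circuits and slackness. -/

section Circuits

variable {G V A : Type*} [Group G] [MulAction G V] [MulAction G A] {T : SelfSimilarGraph G V A}

/-! ### Topological freeness and `G`-circuits -/

/-- If no edge of the path `l` shares its range with another edge, then `l` is a prefix of every
infinite path with the same range. -/
lemma word_eq_of_no_entry {l : List A} (hne : ∀ a ∈ l, ∀ b, T.rng b = T.rng a → b = a) {x : V}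
    (hl : T.IsPathFrom x l) {ω : T.InfPath} (hω : ω.range = x) : ω.word l.length = l := by
  induction l generalizing x ω with
  | nil => rfl
  | cons a l ih =>
    have h0 : ω.edge 0 = a := hne a (by simp) _ (hω.trans hl.1.symm)
    have h1 := ih (fun b hb => hne b (List.mem_cons_of_mem _ hb)) hl.2 (ω := ω.drop 1) (by
      rw [← h0, ω.isPath 0]; rfl)
    rw [List.length_cons, add_comm, ω.word_add, h1]
    simp [InfPath.word, h0]

/-- A path with range `k r(γ)` must start with `k γ`, and what remains has range `φ(k, γ) s(γ) =
φ(k, γ) g r(γ)`, again a translate of `r(γ)`. This is why `k` varies in the induction. -/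
lemma word_eq_of_gCircuit_no_entry {g : G} {γ : T.FinPath} (hγ : IsGCircuit g γ)
    (hne : ¬ HasEntry γ) (n : ℕ) : ∀ (k : G) (ω ω' : T.InfPath), ω.range = k • γ.range →
      ω'.range = k • γ.range → ω.word n = ω'.word n := by
  have hne' : ∀ a ∈ γ.edges, ∀ b, T.rng b = T.rng a → b = a := by
    intro a ha b hb
    by_contra h
    exact hne ⟨a, ha, b, hb, h⟩
  induction n using Nat.strong_induction_on with
  | _ n ih =>
    intro k ω ω' hω hω'
    set m := γ.length with hm
    have first : ∀ ω : T.InfPath, ω.range = k • γ.range → ω.word m = T.actList k γ.edges := by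
      intro ω hω
      have := word_eq_of_no_entry (l := T.actList k γ.edges) ?_
        (T.isPathFrom_actList k γ.isPath) hω
      · rwa [length_actList] at this
      · intro a ha b hb
        obtain ⟨c, a, ha', rfl⟩ := exists_smul_of_mem_actList ha
        rw [T.rng_smul, ← inv_smul_eq_iff, ← T.rng_smul] at hb
        rw [← hne' a ha' _ hb, smul_inv_smul]
    have tail : ∀ ω : T.InfPath, ω.range = k • γ.range →
        (ω.drop m).range = (T.cocList k γ.edges * g) • γ.range := by
      intro ω hω
      rw [mul_smul, ← hγ.2, ← ω.source_take]
      have : ω.take m = γ.act k := FinPath.ext hω (first ω hω)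
      rw [this, FinPath.source_act]
      rfl
    rcases le_or_gt n m with h | h
    · have : ω.take m = ω'.take m :=
        FinPath.ext (hω.trans hω'.symm) ((first ω hω).trans (first ω' hω').symm)
      exact congrArg FinPath.edges (InfPath.take_eq_of_le h this)
    · obtain ⟨j, rfl⟩ := Nat.exists_eq_add_of_le h.le
      rw [ω.word_add, ω'.word_add, first ω hω, first ω' hω',
        ih j (by have := hγ.1; omega) _ _ _ (tail ω hω) (tail ω' hω')]

lemma TopologicallyFree.hasEntry (hT : T.TopologicallyFree) (hsrc : T.NoSources) {g : G}
    {γ : T.FinPath} (hγ : IsGCircuit g γ) : HasEntry γ := by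
  by_contra hne
  have uniq : ∀ ω ω' : T.InfPath, ω.range = γ.range → ω'.range = γ.range → ω = ω' := by
    intro ω ω' h h'
    exact InfPath.ext_word fun n => word_eq_of_gCircuit_no_entry hγ hne n 1 ω ω'
      (by rwa [one_smul]) (by rwa [one_smul])
  let t : T.Triple := ⟨γ, g, ⟨γ.range, [], trivial⟩, hγ.2⟩
  -- The image lies in `Z(γ)`, hence has range `r(γ)` too, and only one infinite path has that
  -- range.
  have fixed : t.β.cylinder ⊆ fixedPoints (SGE.of t) := by
    intro ω hω
    have hr : ω.range = γ.range := FinPath.mem_cylinder_nil.1 hω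
    obtain ⟨ω', h⟩ := exists_acts_of (t := t) hω
    have hr' : ω'.range = γ.range :=
      congrArg FinPath.range (FinPath.mem_cylinder.1 (acts_of_iff.1 h).2.1)
    rwa [uniq ω' ω hr' hr] at h
  obtain ⟨ω, hω⟩ := hsrc.exists_mem_cylinder t.β
  have hfree := hT (.of t) (interior_maximal fixed t.β.isOpen_cylinder hω)
  obtain ⟨δ, hδ, hωδ⟩ := mem_trivialFixedPoints.1 hfree
  have hpre : t.β.IsPrefix δ :=
    FinPath.isPrefix_of_mem_cylinder hω hωδ (Nat.zero_le _)
  obtain ⟨h, e⟩ := of_mul_proj_eq_restrict (t := t) (δ := δ) hpre.1 (l := δ.edges) rfl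
  rw [e] at hδ
  -- A trivial fixed point would give `|γ| + |δ| = |δ|`.
  have := congrArg (fun u : T.Triple => u.α.edges.length) (of_inj.1 hδ)
  simp only [Triple.restrict, List.length_append, length_actList] at this
  have h0 : γ.edges.length ≠ 0 := hγ.1
  change γ.edges.length + _ = _ at this
  omega

/-! ### Topological freeness and slackness -/

/-- Past `γ` the element `φ(g, γ) = 1` acts, so nothing moves any more. -/
lemma StronglyFixed.mono {g : G} {γ δ : T.FinPath} (h : StronglyFixed g γ) (hγδ : γ.IsPrefix δ) :
    StronglyFixed g δ := by
  obtain ⟨hr, l, hl⟩ := hγδ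
  have h₁ : g • γ.range = γ.range := congrArg FinPath.range h.1
  have h₂ : T.actList g γ.edges = γ.edges := congrArg FinPath.edges h.1
  have h₃ : T.cocList g γ.edges = 1 := h.2
  constructor
  · refine FinPath.ext (by simpa [FinPath.act, hr] using h₁) ?_
    simp [FinPath.act, ← hl, actList_append, h₂, h₃, actList_one]
  · simp [FinPath.coc, ← hl, cocList_append, h₃, cocList_one]

lemma TopologicallyFree.isSlackAt (hT : T.TopologicallyFree) (hrow : T.RowFinite)
    {x : V} {g : G} (hg : T.FixesCylinder g x) : T.IsSlackAt g x := by
  by_contra hslack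
  -- `P δ`: strong fixedness fails on arbitrarily long extensions of `δ`.
  let P : T.FinPath → Prop := fun δ => ∀ n, ∃ γ : T.FinPath, δ.IsPrefix γ ∧ n ≤ γ.length ∧
    ¬ StronglyFixed g γ
  have step : ∀ δ, P δ → ∃ (a : A) (h : T.rng a = δ.source), P (δ.snoc a h) := by
    intro δ hδ
    by_contra! H
    have H' : ∀ a, ∃ n, ∀ h : T.rng a = δ.source, ∀ γ : T.FinPath, (δ.snoc a h).IsPrefix γ →
        n ≤ γ.length → StronglyFixed g γ := by
      intro a
      by_cases h : T.rng a = δ.source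
      · have := H a h
        simp only [P] at this
        push Not at this
        obtain ⟨n, hn⟩ := this
        exact ⟨n, fun _ => hn⟩
      · exact ⟨0, fun h' => (h h').elim⟩
    choose n hn using H'
    -- Row-finiteness makes the bounds for the individual edges uniform; the term `δ.length + 1`
    -- below ensures that `γ` really extends `δ` by an edge.
    obtain ⟨N, hN⟩ := ((hrow δ.source).image n).bddAbove
    obtain ⟨γ, hδγ, hlen, hγ⟩ := hδ (max N (δ.length + 1))
    obtain ⟨hr, l, hl⟩ := hδγ
    cases l with
    | nil =>
      have : γ.length = δ.length := by simp [FinPath.length, ← hl]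
      have := le_of_max_le_right hlen
      omega
    | cons a l =>
      have hp := γ.isPath
      rw [← hl, ← hr, T.isPathFrom_append] at hp
      have ha : T.rng a = δ.source := hp.2.1
      refine hγ (hn a ha γ ⟨hr, l, by simp [FinPath.snoc, ← hl]⟩ ?_)
      exact (hN ⟨a, ha, rfl⟩).trans (le_of_max_le_left hlen)
  let δ₀ : T.FinPath := ⟨x, [], trivial⟩
  have h₀ : P δ₀ := by
    intro n
    by_contra! H
    refine hslack ⟨n, fun γ hγ hlen => ?_⟩
    exact H γ ⟨hγ.symm, List.nil_prefix⟩ hlen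
  obtain ⟨ω, hω, hP⟩ := exists_infPath_of_step step δ₀ h₀
  have hx : x = g • x := by
    have := congrArg InfPath.range (hg ω hω)
    rw [InfPath.range_act, FinPath.mem_cylinder_nil.1 hω] at this
    exact this.symm
  let t : T.Triple := ⟨δ₀, g, δ₀, hx⟩
  have fixed : δ₀.cylinder ⊆ fixedPoints (SGE.of t) := by
    intro ω' h
    refine acts_of_iff.2 ⟨h, h, ?_⟩
    have e : ω'.drop δ₀.length = ω' := by
      ext k
      simp [InfPath.drop, δ₀, FinPath.length]
    change ω'.drop δ₀.length = (ω'.drop δ₀.length).act g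
    rw [e, hg ω' h]
  have hfree := hT (.of t) (interior_maximal fixed δ₀.isOpen_cylinder hω)
  obtain ⟨δ, hδ, hωδ⟩ := mem_trivialFixedPoints.1 hfree
  have hpre : t.β.IsPrefix δ := FinPath.isPrefix_of_mem_cylinder hω hωδ (Nat.zero_le _)
  obtain ⟨h, e⟩ := of_mul_proj_eq_restrict (t := t) (δ := δ) hpre.1 (l := δ.edges) rfl
  rw [e] at hδ
  have hSF : StronglyFixed g δ := by
    have h₁ := congrArg (fun u : T.Triple => u.α.edges) (of_inj.1 hδ)
    have h₂ := congrArg (fun u : T.Triple => u.g) (of_inj.1 hδ)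
    refine ⟨FinPath.ext ?_ h₁, h₂⟩
    change g • δ.range = δ.range
    rw [← hpre.1]
    exact hx.symm
  have hPδ : P δ := by
    have := hP δ.length
    rwa [show δ₀.length + δ.length = δ.length from zero_add _,
      FinPath.mem_cylinder.1 hωδ] at this
  obtain ⟨γ, hγ, -, hn⟩ := hPδ 0
  exact hn (hSF.mono hγ)

/-! ### The converse -/

/-- The first `m + j` edges are the first `m` followed by `g` applied to the first `j`, so the
initial `m` edges determine all others. -/
lemma drop_eq_act_unique {g : G} {m : ℕ} (hm : m ≠ 0) {η η' : T.InfPath}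
    (h : η.drop m = η.act g) (h' : η'.drop m = η'.act g) (hw : η.word m = η'.word m) : η = η' := by
  refine InfPath.ext_word fun n => ?_
  induction n using Nat.strong_induction_on with
  | _ n ih =>
    rcases le_or_gt n m with hn | hn
    · refine List.map_inj_left.2 fun k hk => List.map_inj_left.1 hw k ?_
      rw [List.mem_range] at hk ⊢
      omega
    · obtain ⟨j, rfl⟩ := Nat.exists_eq_add_of_le hn.le
      rw [InfPath.word_add, InfPath.word_add, h, h', InfPath.word_act, InfPath.word_act, hw,
        ih j (by omega)]

/-- If every `G`-circuit has an entry, then the fixed points of `(α, g, β)` with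
`|β| < |α|` have empty interior. -/
lemma notMem_interior_fixedPoints_of_length_lt (hsrc : T.NoSources)
    (hentry : ∀ (g : G) (γ : T.FinPath), IsGCircuit g γ → HasEntry γ) {t : T.Triple}
    (ht : t.β.length < t.α.length) (ω : T.InfPath) : ω ∉ interior (fixedPoints (SGE.of t)) := by
  intro hω
  obtain ⟨m, hm⟩ := Nat.exists_eq_add_of_lt ht
  rw [add_assoc] at hm
  have shift : ∀ ω ∈ fixedPoints (SGE.of t),
      (ω.drop t.β.length).drop (m + 1) = (ω.drop t.β.length).act t.g := by
    intro ω h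
    rw [InfPath.drop_drop, ← hm]
    exact (acts_of_iff.1 h).2.2
  set η := ω.drop t.β.length with hη
  have hηs : η.drop (m + 1) = η.act t.g := shift ω (interior_subset hω)
  have hcirc : IsGCircuit t.g (η.take (m + 1)) := by
    refine ⟨by simp, ?_⟩
    rw [InfPath.source_take, hηs, InfPath.range_act]
    rfl
  obtain ⟨a, ha, b, hb, hba⟩ := hentry _ _ hcirc
  obtain ⟨i, -, rfl⟩ := List.mem_map.1 ha
  -- Since `η.drop (m + 1) = g η`, edge `m + 1 + j` is a translate of edge `j`, and the same group
  -- element translates the competing edge `b`.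
  have branch : ∀ k, ∃ j ≥ k, ∃ b, T.rng b = T.rng (η.edge j) ∧ b ≠ η.edge j := by
    intro k
    induction k with
    | zero => exact ⟨i, Nat.zero_le _, b, hb, hba⟩
    | succ k ih =>
      obtain ⟨j, hj, b, hb, hne⟩ := ih
      have he : η.edge (m + 1 + j) = T.cocSeq t.g η.edge j • η.edge j :=
        congrArg (fun ζ : T.InfPath => ζ.edge j) hηs
      refine ⟨m + 1 + j, by omega, T.cocSeq t.g η.edge j • b, ?_, ?_⟩
      · rw [he, T.rng_smul, T.rng_smul, hb]
      · rw [he]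
        exact fun h => hne (MulAction.injective _ h)
  obtain ⟨N, hN⟩ := exists_cylinder_take_subset isOpen_interior hω
  -- Far enough that branching off at `p` stays inside the open set of fixed points (`p ≥ N`) and
  -- leaves the first `|α|` edges unchanged.
  obtain ⟨j, hj, b, hb, hne⟩ := branch (N + m + 1)
  set p := t.β.length + j with hp
  have hbs : T.rng b = (ω.take p).source := by
    rw [InfPath.source_take, hb]; rfl
  obtain ⟨ω', hω'⟩ := hsrc.exists_mem_cylinder ((ω.take p).snoc b hbs)
  have hpre : (ω.take p).IsPrefix ((ω.take p).snoc b hbs) := ⟨rfl, [b], rfl⟩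
  have htake : ω'.take p = ω.take p :=
    InfPath.mem_cylinder_iff_take_eq.1 (hpre.mem_cylinder hω')
  have hfix' : ω' ∈ fixedPoints (SGE.of t) := interior_subset (hN p (by omega)
    (InfPath.mem_cylinder_iff_take_eq.2 htake))
  have hwβ : ω.word t.β.length = ω'.word t.β.length :=
    congrArg FinPath.edges (InfPath.take_eq_of_le (by omega) htake.symm)
  have hwα : ω.word t.α.length = ω'.word t.α.length :=
    congrArg FinPath.edges (InfPath.take_eq_of_le (by omega) htake.symm)
  rw [hm, ω.word_add t.β.length (m + 1), ω'.word_add t.β.length (m + 1), hwβ] at hwα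
  have hηη' : η = ω'.drop t.β.length :=
    drop_eq_act_unique (Nat.succ_ne_zero m) hηs (shift ω' hfix') (List.append_cancel_left hwα)
  have hωω' : ω = ω' := InfPath.ext_take_drop hwβ hηη'
  have hlast := congrArg FinPath.edges (FinPath.mem_cylinder.1 hω')
  have hlen : ((ω.take p).snoc b hbs).length = p + 1 := by
    simp [FinPath.length, FinPath.snoc, InfPath.take]
  rw [hlen, ← hωω'] at hlast
  change ω.word (p + 1) = ω.word p ++ [b] at hlast
  rw [InfPath.word_succ] at hlast
  have := List.append_cancel_left hlast
  simp only [List.cons.injEq, and_true] at this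
  exact hne this.symm

lemma topologicallyFree_of_hasEntry_of_isSlackAt (hsrc : T.NoSources)
    (hentry : ∀ (g : G) (γ : T.FinPath), IsGCircuit g γ → HasEntry γ)
    (hslack : ∀ (x : V) (g : G), T.FixesCylinder g x → T.IsSlackAt g x) :
    T.TopologicallyFree := by
  intro t ω hω
  cases t with
  | zero => exact (interior_subset hω : ω ∈ fixedPoints (.zero : T.SGE)).elim
  | of t =>
    rcases lt_trichotomy t.β.length t.α.length with hlt | heq | hgt
    · exact (notMem_interior_fixedPoints_of_length_lt hsrc hentry hlt ω hω).elim
    · have hmem : ω ∈ fixedPoints (SGE.of t) := interior_subset hω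
      have hfix := acts_of_iff.1 hmem
      obtain ⟨N, hN⟩ := exists_cylinder_take_subset isOpen_interior hω
      set n := t.β.length with hn
      have hαβ : t.α = t.β := by
        rw [← FinPath.mem_cylinder.1 hfix.2.1, ← FinPath.mem_cylinder.1 hfix.1, ← heq]
      set η := ω.drop n with hη
      -- The restriction of `t` to the cylinder of `ω.take (n + N)` has group part `k` and equal
      -- outer paths; as this cylinder consists of fixed points, `k` fixes every path starting at
      -- its source.
      set k := T.cocList t.g (η.word N) with hk
      have hpre : t.β.IsPrefix (ω.take (n + N)) := ω.isPrefix_take hfix.1 (by omega)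
      have hle : t.β.edges ++ η.word N = (ω.take (n + N)).edges := by
        change _ = ω.word _
        rw [ω.word_add]
        congr 1
        exact (congrArg FinPath.edges (FinPath.mem_cylinder.1 hfix.1)).symm
      obtain ⟨hpath, he⟩ := of_mul_proj_eq_restrict hpre.1 hle
      have hηg : η = η.act t.g := by
        have := hfix.2.2
        rwa [← heq] at this
      have hwη : T.actList t.g (η.word N) = η.word N := by
        rw [← InfPath.word_act, ← hηg]
      have hβ : (t.restrict _ hpath).β = ω.take (n + N) := FinPath.ext hpre.1 hle
      have hα : (t.restrict _ hpath).α = ω.take (n + N) := by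
        refine FinPath.ext ?_ ?_
        · exact (congrArg FinPath.range hαβ).trans hpre.1
        · simp only [Triple.restrict, hwη, hαβ]; exact hle
      have hfixcyl : T.FixesCylinder k (ω.take (n + N)).source := by
        intro ζ hζ
        rw [FinPath.mem_cylinder_nil] at hζ
        have hmem : (ω.take (n + N)).appendInf ζ hζ ∈ (ω.take (n + N)).cylinder := ⟨ζ, hζ, rfl⟩
        have hF := interior_subset (hN (n + N) (by omega) hmem)
        have hF' := (acts_of_mul_proj_iff hpre hmem).2 hF
        rw [he, acts_of_iff, hα, hβ, FinPath.drop_appendInf] at hF'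
        exact hF'.2.2.symm
      obtain ⟨M, hM⟩ := hslack _ _ hfixcyl
      -- Following `ω` for `M` more edges makes the group part trivial, so the restriction becomes
      -- an idempotent.
      have hSF := hM ((ω.drop (n + N)).take M) (by rw [InfPath.source_take]; rfl) (by simp)
      refine mem_trivialFixedPoints.2 ⟨ω.take (n + N + M), ?_, ω.mem_cylinder_take _⟩
      have hle' : t.β.edges ++ (η.word N ++ (ω.drop (n + N)).word M) =
          (ω.take (n + N + M)).edges := by
        rw [← List.append_assoc, hle]
        exact (ω.word_add _ _).symm
      obtain ⟨hpath', he'⟩ := of_mul_proj_eq_restrict (t := t) (δ := ω.take (n + N + M))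
        hpre.1 hle'
      rw [he', FinPath.proj, of_inj]
      have hSF₁ : T.actList k ((ω.drop (n + N)).word M) = (ω.drop (n + N)).word M :=
        congrArg FinPath.edges hSF.1
      have hSF₂ : T.cocList k ((ω.drop (n + N)).word M) = 1 := hSF.2
      refine Triple.ext (FinPath.ext ?_ ?_) ?_ (FinPath.ext hpre.1 hle')
      · exact (congrArg FinPath.range hαβ).trans hpre.1
      · simp only [Triple.restrict, actList_append, hwη, hαβ, ← hk, hSF₁]; exact hle'
      · simp only [Triple.restrict, cocList_append, ← hk, hSF₂]
    · refine (notMem_interior_fixedPoints_of_length_lt hsrc hentry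
        (t := ⟨t.β, t.g⁻¹, t.α, by rw [t.source_eq, inv_smul_smul]⟩) hgt ω ?_).elim
      have : fixedPoints (star (SGE.of t)) = fixedPoints (SGE.of t) :=
        Set.ext fun ω => acts_star_iff (t := SGE.of t) (ω := ω) (ω' := ω)
      rwa [← this] at hω

end Circuits

/-! ### Tight filters as infinite paths, and germs as pairs of an element and an infinite path. -/

section TightGroupoid

variable {G V A : Type*} [Group G] [MulAction G V] [MulAction G A] {T : SelfSimilarGraph G V A}

/-! ### Tight filters are infinite paths -/

/-- The filter of the idempotents whose domain contains `ω`. -/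
def InfPath.filter (ω : T.InfPath) : Set T.SGE := {e | ∃ δ : T.FinPath, ω ∈ δ.cylinder ∧ e = δ.proj}

lemma InfPath.proj_mem_filter {ω : T.InfPath} {δ : T.FinPath} :
    δ.proj ∈ ω.filter ↔ ω ∈ δ.cylinder :=
  ⟨fun ⟨_, h, e⟩ => by rwa [FinPath.proj_inj.1 e], fun h => ⟨δ, h, rfl⟩⟩

lemma InfPath.zero_notMem_filter (ω : T.InfPath) : (0 : T.SGE) ∉ ω.filter :=
  fun ⟨δ, _, e⟩ => δ.proj_ne_zero e.symm

lemma InfPath.isFilter_filter (ω : T.InfPath) : IsFilter ω.filter where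
  subset := by rintro _ ⟨δ, -, rfl⟩; exact proj_mem_idem δ
  nonempty := ⟨_, ω.take 0, ω.mem_cylinder_take 0, rfl⟩
  zero_notMem := ω.zero_notMem_filter
  mul_mem := by
    rintro _ ⟨δ, hδ, rfl⟩ _ ⟨ε, hε, rfl⟩
    rcases le_total δ.length ε.length with h | h
    · rw [proj_mul_proj_of_isPrefix' (FinPath.isPrefix_of_mem_cylinder hδ hε h)]
      exact ⟨ε, hε, rfl⟩
    · rw [proj_mul_proj_of_isPrefix (FinPath.isPrefix_of_mem_cylinder hε hδ h)]
      exact ⟨δ, hδ, rfl⟩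
  upward := by
    rintro _ ⟨δ, hδ, rfl⟩ f hf h
    rcases mem_idem.1 hf with rfl | ⟨ε, rfl⟩
    · exact (δ.proj_ne_zero (by rw [← h, mul_zero'])).elim
    · exact ⟨ε, (proj_mul_proj_eq_left.1 h).mem_cylinder hδ, rfl⟩

/-- The length of the path of an idempotent. -/
def sgeLength : T.SGE → ℕ
  | .zero => 0
  | .of t => t.α.length

lemma sgeLength_proj (δ : T.FinPath) : sgeLength δ.proj = δ.length := rfl

/-- Let `N` bound the lengths of all paths in `X`, `Y`, `Z`. An idempotent with path of length at
most `N` meets that of `ω.take N` only if its cylinder contains `ω`. So `ω.take N` gives an element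
of `below X Y`, and whatever member of `Z` meets it lies in the filter. -/
lemma InfPath.isTight_filter (ω : T.InfPath) : IsTight ω.filter := by
  refine ⟨ω.isFilter_filter, fun X Y Z hX hY hZ hXi hYi hcov hXω hYω => ?_⟩
  obtain ⟨N, hN⟩ := (((hX.union hY).union hZ).image sgeLength).bddAbove
  have hlen : ∀ δ : T.FinPath, δ.proj ∈ X ∪ Y ∪ Z → δ.length ≤ N :=
    fun δ hδ => hN ⟨_, hδ, sgeLength_proj δ⟩
  have hmem : (ω.take N).proj ∈ below X Y := by
    refine ⟨proj_mem_idem _, fun x hx => ?_, fun y hy => ?_⟩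
    · obtain ⟨δ, hδ, rfl⟩ := hXω hx
      exact proj_mul_proj_of_isPrefix (ω.isPrefix_take hδ (hlen δ (.inl (.inl hx))))
    · rcases mem_idem.1 (hYi hy) with rfl | ⟨δ, rfl⟩
      · exact mul_zero' _
      · have hn : ω ∉ δ.cylinder := fun h => Set.disjoint_left.1 hYω hy ⟨δ, h, rfl⟩
        have hle := hlen δ (.inl (.inr hy))
        by_contra h0
        rcases proj_mul_proj_ne_zero.1 h0 with h | h
        · refine hn ?_
          rw [← h.eq_of_length_le (by simpa using hle)]
          exact ω.mem_cylinder_take N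
        · exact hn (h.mem_cylinder (ω.mem_cylinder_take N))
  obtain ⟨z, hz, hne⟩ := hcov.2 _ hmem (FinPath.proj_ne_zero _)
  rcases mem_idem.1 (hcov.1 hz).1 with rfl | ⟨δ, rfl⟩
  · exact (hne rfl).elim
  · refine ⟨_, hz, δ, ?_, rfl⟩
    have hle := hlen δ (.inr hz)
    rcases proj_mul_proj_ne_zero.1 hne with h | h
    · exact h.mem_cylinder (ω.mem_cylinder_take N)
    · rw [← h.eq_of_length_le (by simpa using hle)]
      exact ω.mem_cylinder_take N

/-- The tight filter of an infinite path. -/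
def InfPath.tight (ω : T.InfPath) : T.TightSpectrum := ⟨ω.filter, ω.isTight_filter⟩

lemma InfPath.filter_injective {ω ω' : T.InfPath} (h : ω.filter = ω'.filter) : ω = ω' := by
  refine InfPath.ext_word fun n => ?_
  have : (ω.take n).proj ∈ ω'.filter := by
    rw [← h]; exact InfPath.proj_mem_filter.2 (ω.mem_cylinder_take n)
  have := InfPath.mem_cylinder_iff_take_eq.1 (InfPath.proj_mem_filter.1 this)
  exact congrArg FinPath.edges this.symm

/-- The one-edge extensions of `δ` cover the idempotents below `δ.proj`. Row-finiteness makes this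
cover finite; the absence of sources is needed for `δ.proj` itself to be met. -/
lemma IsTight.exists_snoc (hrow : T.RowFinite) (hsrc : T.NoSources) {ξ : Set T.SGE}
    (hξ : IsTight ξ) {δ : T.FinPath} (hδ : δ.proj ∈ ξ) :
    ∃ (a : A) (h : T.rng a = δ.source), (δ.snoc a h).proj ∈ ξ := by
  let Z : Set T.SGE := {e | ∃ (a : A) (h : T.rng a = δ.source), e = (δ.snoc a h).proj}
  have hpre : ∀ (a : A) (h : T.rng a = δ.source), δ.IsPrefix (δ.snoc a h) :=
    fun a h => ⟨rfl, [a], rfl⟩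
  have hZ : Z.Finite := by
    refine ((hrow δ.source).dependent_image fun a ha => (δ.snoc a ha).proj).subset ?_
    rintro _ ⟨a, h, rfl⟩
    exact ⟨a, h, rfl⟩
  have hcov : IsCover Z (below {δ.proj} ∅) := by
    constructor
    · rintro _ ⟨a, h, rfl⟩
      refine ⟨proj_mem_idem _, ?_, fun y hy => hy.elim⟩
      rintro _ rfl
      exact proj_mul_proj_of_isPrefix (hpre a h)
    · intro f hf hf0
      rcases mem_idem.1 hf.1 with rfl | ⟨ε, rfl⟩
      · exact (hf0 rfl).elim
      · obtain ⟨hr, l, hl⟩ := proj_mul_proj_eq_left.1 (hf.2.1 _ rfl)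
        cases l with
        | nil =>
          obtain ⟨a, ha⟩ := hsrc δ.source
          refine ⟨_, ⟨a, ha, rfl⟩, proj_mul_proj_ne_zero.2 (.inr ?_)⟩
          exact ⟨hr.symm, [a], by simp [FinPath.snoc, ← hl]⟩
        | cons a l =>
          have hp := ε.isPath
          rw [← hl, ← hr, T.isPathFrom_append] at hp
          refine ⟨_, ⟨a, hp.2.1, rfl⟩, proj_mul_proj_ne_zero.2 (.inl ?_)⟩
          exact ⟨hr, l, by simp [FinPath.snoc, ← hl]⟩
  obtain ⟨z, ⟨a, h, rfl⟩, hz⟩ := hξ.2 {δ.proj} ∅ Z (Set.finite_singleton _) Set.finite_empty hZ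
    (Set.singleton_subset_iff.2 (proj_mem_idem δ)) (Set.empty_subset _) hcov
    (Set.singleton_subset_iff.2 hδ) (Set.empty_disjoint _)
  exact ⟨a, h, hz⟩

lemma exists_tight_eq (hrow : T.RowFinite) (hsrc : T.NoSources) (ξ : T.TightSpectrum) :
    ∃ ω : T.InfPath, ω.tight = ξ := by
  obtain ⟨ξ, hξ⟩ := ξ
  obtain ⟨e, he⟩ := hξ.1.nonempty
  rcases mem_idem.1 (hξ.1.subset he) with rfl | ⟨δ, rfl⟩
  · exact (hξ.1.zero_notMem he).elim
  · obtain ⟨ω, hω, h⟩ := exists_infPath_of_step (P := fun δ : T.FinPath => δ.proj ∈ ξ)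
      (fun δ hδ => hξ.exists_snoc hrow hsrc hδ) δ he
    refine ⟨ω, Subtype.ext ?_⟩
    change ω.filter = ξ
    ext f
    constructor
    · rintro ⟨ε, hε, rfl⟩
      exact hξ.1.upward _ (h ε.length) _ (proj_mem_idem ε)
        (proj_mul_proj_of_isPrefix (ω.isPrefix_take hε (by omega)))
    · intro hf
      rcases mem_idem.1 (hξ.1.subset hf) with rfl | ⟨ε, rfl⟩
      · exact (hξ.1.zero_notMem hf).elim
      · refine ⟨ε, ?_, rfl⟩
        -- Two members of a filter have comparable paths, and this prefix of `ω` is at least as long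
        -- as `ε`.
        have h0 : ε.proj * (ω.take (δ.length + ε.length)).proj ≠ 0 := fun h0 =>
          hξ.1.zero_notMem (h0 ▸ hξ.1.mul_mem _ hf _ (h ε.length))
        rcases proj_mul_proj_ne_zero.1 h0 with h1 | h1
        · exact h1.mem_cylinder (ω.mem_cylinder_take _)
        · rw [← h1.eq_of_length_le (by simp)]
          exact ω.mem_cylinder_take _

lemma continuous_tight : Continuous (InfPath.tight (T := T)) := by
  refine continuous_generateFrom_iff.2 ?_
  rintro _ ⟨e, he, h⟩
  rcases mem_idem.1 he with rfl | ⟨δ, rfl⟩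
  · rcases h with rfl | rfl
    · convert isOpen_empty
      ext ω
      exact iff_of_false ω.zero_notMem_filter id
    · convert isOpen_univ
      ext ω
      exact iff_of_true ω.zero_notMem_filter trivial
  · rcases h with rfl | rfl
    · convert δ.isOpen_cylinder
      ext ω
      exact InfPath.proj_mem_filter
    · convert δ.isOpen_compl_cylinder
      ext ω
      exact InfPath.proj_mem_filter.not

lemma isOpen_image_tight (hrow : T.RowFinite) (hsrc : T.NoSources) {U : Set T.InfPath}
    (hU : IsOpen U) : IsOpen (InfPath.tight '' U) := by
  rw [isOpen_iff_forall_mem_open]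
  rintro _ ⟨ω, hω, rfl⟩
  obtain ⟨n, hn⟩ := exists_cylinder_take_subset hU hω
  refine ⟨{ξ | (ω.take n).proj ∈ ξ.1}, ?_,
    TopologicalSpace.isOpen_generateFrom_of_mem ⟨_, proj_mem_idem _, .inl rfl⟩,
    InfPath.proj_mem_filter.2 (ω.mem_cylinder_take n)⟩
  intro ξ hξ
  obtain ⟨ω', rfl⟩ := exists_tight_eq hrow hsrc ξ
  exact ⟨ω', hn n le_rfl (InfPath.proj_mem_filter.1 hξ), rfl⟩

/-! ### The action on tight filters -/

lemma FinPath.mem_cylinder_iff_word_drop {γ δ : T.FinPath} {l : List A} (hr : γ.range = δ.range)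
    (hl : γ.edges ++ l = δ.edges) {ω : T.InfPath} (hω : ω ∈ γ.cylinder) :
    ω ∈ δ.cylinder ↔ (ω.drop γ.length).word l.length = l := by
  rw [FinPath.mem_cylinder] at hω ⊢
  have hlen : δ.length = γ.length + l.length := by simp [FinPath.length, ← hl]
  have he : ω.word γ.length = γ.edges := congrArg FinPath.edges hω
  constructor
  · intro h
    have h' : ω.word δ.length = δ.edges := congrArg FinPath.edges h
    rw [hlen, ω.word_add, ← hl, he] at h'
    exact List.append_cancel_left h'
  · intro h
    refine FinPath.ext ((congrArg FinPath.range hω).trans hr) ?_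
    change ω.word _ = _
    rw [hlen, ω.word_add, he, h, hl]

/-- For `δ = α l` the product is the idempotent of `β (g⁻¹ l)`; for `δ` a prefix of `α` it is that
of `β`; otherwise it vanishes and `ω' ∈ Z(α)` avoids `Z(δ)`. -/
lemma proj_mem_translate_filter {t : T.Triple} {ω ω' : T.InfPath} (h : Acts (SGE.of t) ω ω')
    (δ : T.FinPath) : star (SGE.of t) * δ.proj * SGE.of t ∈ ω.filter ↔ ω' ∈ δ.cylinder := by
  obtain ⟨hβ, hα, hd⟩ := acts_of_iff.1 h
  let s : T.Triple := ⟨t.β, t.g⁻¹, t.α, by rw [t.source_eq, inv_smul_smul]⟩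
  have hs : star (SGE.of t) = SGE.of s := rfl
  by_cases h₁ : t.α.IsPrefix δ
  · obtain ⟨hr, l, hl⟩ := h₁
    obtain ⟨hp, e⟩ := of_mul_proj_eq_restrict (t := s) (δ := δ) hr hl
    have hprod : star (SGE.of t) * δ.proj * SGE.of t = (s.restrict l hp).α.proj := by
      rw [hs, e]
      refine of_mul_of_extend' l rfl rfl rfl ?_ rfl rfl
      simp [Triple.restrict, s]
    rw [hprod, InfPath.proj_mem_filter, FinPath.mem_cylinder_iff_word_drop hr hl hα,
      FinPath.mem_cylinder_iff_word_drop (γ := t.β)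
        (δ := (s.restrict l hp).α) (l := T.actList t.g⁻¹ l) rfl rfl hβ, hd,
      InfPath.word_act, length_actList]
    constructor
    · intro H
      rw [H, ← actList_mul, mul_inv_cancel, actList_one]
    · intro H
      conv_rhs => rw [← H]
      rw [← actList_mul, inv_mul_cancel, actList_one]
  · by_cases h₂ : δ.IsPrefix t.α
    · have : star (SGE.of t) * δ.proj = star (SGE.of t) := by
        rw [hs]; exact of_mul_proj_of_isPrefix h₂
      rw [this, star_mul_self, InfPath.proj_mem_filter]
      exact iff_of_true hβ (h₂.mem_cylinder hα)
    · have : star (SGE.of t) * δ.proj = 0 := of_mul_of_eq_zero h₁ h₂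
      rw [this, zero_mul']
      refine iff_of_false ω.zero_notMem_filter fun hδ => ?_
      rcases le_total t.α.length δ.length with hle | hle
      · exact h₁ (FinPath.isPrefix_of_mem_cylinder hα hδ hle)
      · exact h₂ (FinPath.isPrefix_of_mem_cylinder hδ hα hle)

lemma translate_filter {t : T.Triple} {ω ω' : T.InfPath} (h : Acts (SGE.of t) ω ω') :
    translate (SGE.of t) ω.filter = ω'.filter := by
  ext f
  constructor
  · rintro ⟨hf, hmem⟩
    rcases mem_idem.1 hf with rfl | ⟨δ, rfl⟩
    · rw [mul_zero', zero_mul'] at hmem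
      exact (ω.zero_notMem_filter hmem).elim
    · exact ⟨δ, (proj_mem_translate_filter h δ).1 hmem, rfl⟩
  · rintro ⟨δ, hδ, rfl⟩
    exact ⟨proj_mem_idem δ, (proj_mem_translate_filter h δ).2 hδ⟩

lemma translate_filter_eq_iff {t : T.Triple} {ω : T.InfPath} (hω : ω ∈ t.β.cylinder) :
    translate (SGE.of t) ω.filter = ω.filter ↔ ω ∈ fixedPoints (SGE.of t) := by
  obtain ⟨ω', h⟩ := exists_acts_of hω
  rw [translate_filter h]
  constructor
  · intro e
    rw [InfPath.filter_injective e] at h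
    exact h
  · intro H
    rw [h.unique H]

/-! ### Germs -/

/-- The germ of `t` at `ω`. -/
def Triple.germRep (t : T.Triple) (ω : T.InfPath) (h : ω ∈ t.β.cylinder) : T.GermRep :=
  ⟨SGE.of t, ω.tight, by rw [star_mul_self]; exact InfPath.proj_mem_filter.2 h⟩

lemma exists_germRep_eq (hrow : T.RowFinite) (hsrc : T.NoSources) (p : T.GermRep) :
    ∃ t ω h, p = Triple.germRep t ω h := by
  obtain ⟨s, ξ, hs⟩ := p
  obtain ⟨ω, rfl⟩ := exists_tight_eq hrow hsrc ξ
  cases s with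
  | zero => exact (ω.zero_notMem_filter hs).elim
  | of t =>
    refine ⟨t, ω, ?_, rfl⟩
    rw [star_mul_self] at hs
    exact InfPath.proj_mem_filter.1 hs

lemma of_mul_proj_take_eq_of_le {t u : T.Triple} {ω : T.InfPath} (ht : ω ∈ t.β.cylinder)
    (hu : ω ∈ u.β.cylinder) {δ : T.FinPath} (hδ : ω ∈ δ.cylinder)
    (h : SGE.of t * δ.proj = SGE.of u * δ.proj) {n : ℕ} (hnt : t.β.length ≤ n)
    (hnu : u.β.length ≤ n) (hn : δ.length ≤ n) :
    SGE.of t * (ω.take n).proj = SGE.of u * (ω.take n).proj := by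
  rw [← of_mul_proj_mul_proj (ω.isPrefix_take hδ hn) (ω.isPrefix_take ht hnt), h,
    of_mul_proj_mul_proj (ω.isPrefix_take hδ hn) (ω.isPrefix_take hu hnu)]

/-- Equality at all large `n`, rather than at one idempotent, makes transitivity immediate. -/
lemma sameGerm_germRep_iff {t u : T.Triple} {ω ω' : T.InfPath} (ht : ω ∈ t.β.cylinder)
    (hu : ω' ∈ u.β.cylinder) : SameGerm (t.germRep ω ht) (u.germRep ω' hu) ↔
      ω = ω' ∧ ∃ N, ∀ n ≥ N, SGE.of t * (ω.take n).proj = SGE.of u * (ω.take n).proj := by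
  constructor
  · rintro ⟨hpt, e, -, ⟨δ, hδ, rfl⟩, h⟩
    obtain rfl : ω = ω' := InfPath.filter_injective (congrArg Subtype.val hpt)
    refine ⟨rfl, max δ.length (max t.β.length u.β.length), fun n hn => ?_⟩
    simp only [ge_iff_le, max_le_iff] at hn
    exact of_mul_proj_take_eq_of_le ht hu hδ h hn.2.1 hn.2.2 hn.1
  · rintro ⟨rfl, N, hN⟩
    exact ⟨rfl, _, proj_mem_idem _, ⟨_, ω.mem_cylinder_take N, rfl⟩, hN N le_rfl⟩

/-- Needed because `Quot` a priori identifies along the generated equivalence relation. -/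
lemma sameGerm_equivalence (hrow : T.RowFinite) (hsrc : T.NoSources) :
    Equivalence (SameGerm (T := T)) where
  refl p := by
    obtain ⟨t, ω, h, rfl⟩ := exists_germRep_eq hrow hsrc p
    exact (sameGerm_germRep_iff _ _).2 ⟨rfl, 0, fun _ _ => rfl⟩
  symm {p q} := by
    obtain ⟨t, ω, h, rfl⟩ := exists_germRep_eq hrow hsrc p
    obtain ⟨u, ω', h', rfl⟩ := exists_germRep_eq hrow hsrc q
    rw [sameGerm_germRep_iff, sameGerm_germRep_iff]
    rintro ⟨rfl, N, hN⟩
    exact ⟨rfl, N, fun n hn => (hN n hn).symm⟩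
  trans {p q r} := by
    obtain ⟨t, ω, h, rfl⟩ := exists_germRep_eq hrow hsrc p
    obtain ⟨u, ω', h', rfl⟩ := exists_germRep_eq hrow hsrc q
    obtain ⟨v, ω'', h'', rfl⟩ := exists_germRep_eq hrow hsrc r
    rw [sameGerm_germRep_iff, sameGerm_germRep_iff, sameGerm_germRep_iff]
    rintro ⟨rfl, N, hN⟩ ⟨rfl, M, hM⟩
    exact ⟨rfl, max N M, fun n hn => (hN n (le_of_max_le_left hn)).trans
      (hM n (le_of_max_le_right hn))⟩

lemma mk_eq_mk_iff (hrow : T.RowFinite) (hsrc : T.NoSources) {p q : T.GermRep} :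
    (Quot.mk _ p : T.TightGroupoid) = Quot.mk _ q ↔ SameGerm p q :=
  Quot.eq.trans (sameGerm_equivalence hrow hsrc).eqvGen_iff

lemma mk_germRep_eq_iff (hrow : T.RowFinite) (hsrc : T.NoSources) {t u : T.Triple}
    {ω ω' : T.InfPath} (ht : ω ∈ t.β.cylinder) (hu : ω' ∈ u.β.cylinder) :
    (Quot.mk _ (t.germRep ω ht) : T.TightGroupoid) = Quot.mk _ (u.germRep ω' hu) ↔
      ω = ω' ∧ ∃ N, ∀ n ≥ N, SGE.of t * (ω.take n).proj = SGE.of u * (ω.take n).proj :=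
  (mk_eq_mk_iff hrow hsrc).trans (sameGerm_germRep_iff ht hu)

lemma mk_germRep_mem_isotropy (hrow : T.RowFinite) (hsrc : T.NoSources) {t : T.Triple}
    {ω : T.InfPath} (ht : ω ∈ t.β.cylinder) :
    (Quot.mk _ (t.germRep ω ht) : T.TightGroupoid) ∈ T.isotropy ↔
      ω ∈ fixedPoints (SGE.of t) := by
  constructor
  · rintro ⟨p, hp, h⟩
    obtain ⟨u, ω', hu, rfl⟩ := exists_germRep_eq hrow hsrc p
    obtain ⟨rfl, N, hN⟩ := (mk_germRep_eq_iff hrow hsrc ht hu).1 h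
    have hfix : Acts (SGE.of u) ω ω := (translate_filter_eq_iff hu).1 hp
    -- The isotropy witness `u` may differ from `t`; at this length their restrictions coincide, so
    -- fixing `ω` passes from `u` to `t`.
    set n := max N (max t.β.length u.β.length) with hn
    have hn₁ : N ≤ n := le_max_left _ _
    have hn₂ : t.β.length ≤ n := (le_max_left _ _).trans (le_max_right _ _)
    have hn₃ : u.β.length ≤ n := (le_max_right _ _).trans (le_max_right _ _)
    rw [← acts_of_mul_proj_iff (ω.isPrefix_take hu hn₃) (ω.mem_cylinder_take n),
      ← hN n hn₁, acts_of_mul_proj_iff (ω.isPrefix_take ht hn₂) (ω.mem_cylinder_take n)] at hfix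
    exact hfix
  · intro h
    exact ⟨_, (translate_filter_eq_iff ht).2 h, rfl⟩

lemma mk_germRep_mem_unitSpace (hrow : T.RowFinite) (hsrc : T.NoSources) {t : T.Triple}
    {ω : T.InfPath} (ht : ω ∈ t.β.cylinder) :
    (Quot.mk _ (t.germRep ω ht) : T.TightGroupoid) ∈ T.unitSpace ↔
      ω ∈ trivialFixedPoints (SGE.of t) := by
  rw [mem_trivialFixedPoints]
  constructor
  · rintro ⟨p, hp, h⟩
    obtain ⟨u, ω', hu, rfl⟩ := exists_germRep_eq hrow hsrc p
    obtain ⟨rfl, N, hN⟩ := (mk_germRep_eq_iff hrow hsrc ht hu).1 h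
    rcases mem_idem.1 hp with h0 | ⟨δ, hδ⟩
    · exact (of_ne_zero u h0).elim
    · have hδ : SGE.of u = δ.proj := hδ
      obtain rfl := of_inj.1 hδ
      refine ⟨ω.take (max N δ.length), ?_, ω.mem_cylinder_take _⟩
      rw [hN _ (le_max_left _ _), hδ]
      exact proj_mul_proj_of_isPrefix' (ω.isPrefix_take hu (le_max_right _ _))
  · rintro ⟨δ, hδ, hω⟩
    refine ⟨Triple.germRep ⟨δ, 1, δ, (one_smul _ _).symm⟩ ω hω, proj_mem_idem δ, ?_⟩
    refine (mk_eq_mk_iff hrow hsrc).2 ⟨rfl, _, proj_mem_idem δ,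
      InfPath.proj_mem_filter.2 hω, hδ.trans (proj_mem_idem δ).symm⟩

lemma trivialFixedPoints_subset (t : T.Triple) {ω : T.InfPath} (ht : ω ∈ t.β.cylinder)
    (h : ω ∈ trivialFixedPoints (SGE.of t)) : ω ∈ fixedPoints (SGE.of t) := by
  obtain ⟨δ, hδ, hω⟩ := mem_trivialFixedPoints.1 h
  set n := max t.β.length δ.length
  have hp := ω.isPrefix_take ht (le_max_left t.β.length δ.length)
  have hq := ω.isPrefix_take hω (le_max_right t.β.length δ.length)
  have e : SGE.of t * (ω.take n).proj = (ω.take n).proj := by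
    rw [← of_mul_proj_mul_proj hq hp, hδ, proj_mul_proj_of_isPrefix' hq]
  have : Acts (SGE.of t * (ω.take n).proj) ω ω := by
    rw [e]; exact acts_proj_iff.2 ⟨ω.mem_cylinder_take n, rfl⟩
  exact (acts_of_mul_proj_iff hp (ω.mem_cylinder_take n)).1 this

/-- The germs of a fixed element of `S_{G,E}` depend continuously on the base point. -/
lemma isOpen_setOf_mk_germRep_mem (hrow : T.RowFinite) (hsrc : T.NoSources) (t : T.Triple)
    {W : Set T.TightGroupoid} (hW : IsOpen W) :
    IsOpen {ω | ∃ h, (Quot.mk _ (t.germRep ω h) : T.TightGroupoid) ∈ W} := by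
  induction hW with
  | basic s hs =>
    obtain ⟨u, U, hU, rfl⟩ := hs
    refine isOpen_of_cylinder_take_subset ?_
    rintro ω ⟨ht, p, hpu, hpU, h⟩
    obtain ⟨u, ω', hu, rfl⟩ := exists_germRep_eq hrow hsrc p
    subst hpu
    obtain ⟨rfl, N, hN⟩ := (mk_germRep_eq_iff hrow hsrc ht hu).1 h
    obtain ⟨M, hM⟩ := exists_cylinder_take_subset (hU.preimage continuous_tight) hpU
    -- Beyond this length `t` and `u` have the same restriction and the cylinder maps into `U`, so
    -- one idempotent witnesses equality of germs at all nearby points.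
    set n := max (max N M) (max t.β.length u.β.length) with hn
    have hn₀ : N ≤ n := by omega
    have hn₁ : M ≤ n := by omega
    have hn₂ : t.β.length ≤ n := by omega
    have hn₃ : u.β.length ≤ n := by omega
    refine ⟨n, fun ζ hζ => ?_⟩
    have htζ : ζ ∈ t.β.cylinder := (ω.isPrefix_take ht hn₂).mem_cylinder hζ
    have huζ : ζ ∈ u.β.cylinder := (ω.isPrefix_take hu hn₃).mem_cylinder hζ
    refine ⟨htζ, u.germRep ζ huζ, rfl, hM n hn₁ hζ, ?_⟩
    exact (mk_eq_mk_iff hrow hsrc).2 ⟨rfl, _, proj_mem_idem _,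
      InfPath.proj_mem_filter.2 hζ, hN n hn₀⟩
  | univ =>
    convert t.β.isOpen_cylinder
    exact Set.ext fun _ => ⟨fun ⟨h, _⟩ => h, fun h => ⟨h, trivial⟩⟩
  | inter s s' _ _ hs hs' =>
    convert hs.inter hs' using 1
    ext ω
    exact ⟨fun ⟨h, h₁, h₂⟩ => ⟨⟨h, h₁⟩, ⟨h, h₂⟩⟩, fun ⟨⟨h, h₁⟩, ⟨_, h₂⟩⟩ => ⟨h, h₁, h₂⟩⟩
  | sUnion S _ ih =>
    convert isOpen_sUnion (s := (fun s => {ω | ∃ h,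
      (Quot.mk _ (t.germRep ω h) : T.TightGroupoid) ∈ s}) '' S) ?_ using 1
    · ext ω
      simp only [Set.sUnion_image, Set.mem_iUnion]
      exact ⟨fun ⟨h, s, hs, h'⟩ => ⟨s, hs, h, h'⟩, fun ⟨s, hs, h, h'⟩ => ⟨h, s, hs, h'⟩⟩
    · rintro _ ⟨s, hs, rfl⟩
      exact ih s hs

lemma isOpen_unitSpace : IsOpen T.unitSpace := by
  have : T.unitSpace = ⋃ e ∈ T.idem, Theta e Set.univ := by
    ext γ
    simp only [Set.mem_iUnion]
    constructor
    · rintro ⟨p, hp, rfl⟩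
      exact ⟨p.elt, hp, p, rfl, trivial, rfl⟩
    · rintro ⟨_, he, p, rfl, -, rfl⟩
      exact ⟨p, he, rfl⟩
  rw [this]
  exact isOpen_biUnion fun e _ =>
    TopologicalSpace.isOpen_generateFrom_of_mem ⟨e, _, isOpen_univ, rfl⟩

lemma unitSpace_subset_isotropy (hrow : T.RowFinite) (hsrc : T.NoSources) :
    T.unitSpace ⊆ T.isotropy := by
  intro γ hγ
  induction γ using Quot.ind with
  | _ p =>
    obtain ⟨t, ω, ht, rfl⟩ := exists_germRep_eq hrow hsrc p
    exact (mk_germRep_mem_isotropy hrow hsrc ht).2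
      (trivialFixedPoints_subset t ht ((mk_germRep_mem_unitSpace hrow hsrc ht).1 hγ))

theorem topologicallyFree_iff_essentiallyPrincipal (hrow : T.RowFinite) (hsrc : T.NoSources) :
    T.TopologicallyFree ↔ T.EssentiallyPrincipal := by
  constructor
  · intro hT
    refine Set.Subset.antisymm ?_ (interior_maximal (unitSpace_subset_isotropy hrow hsrc)
      isOpen_unitSpace)
    intro γ hγ
    induction γ using Quot.ind with
    | _ p =>
      obtain ⟨t, ω, ht, rfl⟩ := exists_germRep_eq hrow hsrc p
      refine (mk_germRep_mem_unitSpace hrow hsrc ht).2 (hT (.of t) ?_)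
      -- The points at which the germ of `t` is interior isotropy form an open set of fixed points
      -- of `t`.
      refine interior_maximal ?_
        (isOpen_setOf_mk_germRep_mem hrow hsrc t (isOpen_interior (s := T.isotropy))) ⟨ht, hγ⟩
      rintro ζ ⟨hζ, h⟩
      exact (mk_germRep_mem_isotropy hrow hsrc hζ).1 (interior_subset (X := T.TightGroupoid) h)
  · intro hE t ω hω
    have hfix : ω ∈ fixedPoints t := interior_subset hω
    cases t with
    | zero => exact hfix.elim
    | of t =>
      have ht : ω ∈ t.β.cylinder := (acts_of_iff.1 hfix).1
      rw [← mk_germRep_mem_unitSpace hrow hsrc ht, ← hE]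
      -- Conversely, the germs of `t` over the interior of its fixed points form an open set of
      -- isotropy.
      have hopen : IsOpen (Theta (SGE.of t) (InfPath.tight '' interior (fixedPoints (SGE.of t)))) :=
        TopologicalSpace.isOpen_generateFrom_of_mem
          ⟨_, _, isOpen_image_tight hrow hsrc isOpen_interior, rfl⟩
      refine interior_maximal ?_ hopen ⟨t.germRep ω ht, rfl, ⟨ω, hω, rfl⟩, rfl⟩
      rintro _ ⟨⟨s, ξ, hs⟩, rfl, ⟨ζ, hζ, rfl⟩, rfl⟩
      have hfixζ : ζ ∈ fixedPoints (SGE.of t) := interior_subset hζ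
      exact ⟨_, translate_filter hfixζ, rfl⟩

end TightGroupoid

end SelfSimilarGraph

theorem theorem4p4 {G V A : Type*} [Group G] [MulAction G V] [MulAction G A]
    [Countable V] [Countable A] (T : SelfSimilarGraph G V A)
    (hrow : T.RowFinite) (hsrc : T.NoSources) :
    (T.TopologicallyFree ↔ T.EssentiallyPrincipal) ∧
    (T.TopologicallyFree ↔
      (∀ (g : G) (γ : T.FinPath), SelfSimilarGraph.IsGCircuit g γ →
        SelfSimilarGraph.HasEntry γ) ∧
      (∀ (x : V) (g : G), T.FixesCylinder g x → T.IsSlackAt g x)) := by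
  exact ⟨SelfSimilarGraph.topologicallyFree_iff_essentiallyPrincipal hrow hsrc,
    fun hT => ⟨fun _ _ hγ => hT.hasEntry hsrc hγ, fun _ _ hg => hT.isSlackAt hrow hg⟩,
    fun h => SelfSimilarGraph.topologicallyFree_of_hasEntry_of_isSlackAt hsrc h.1 h.2⟩
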